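/- **Model.** Let $n\ge 1$ and $p\in(0,1]$. Candidates with overall ranks $1$ (best) to $n$ arrive in uniformly random order $(R_1,\dots,R_n)$. At time $t$ one observes the partial rank $r_t\in\{1,\dots,t\}$ of the $t$-th candidate among the first $t$. A (randomized) policy $\mathcal P$ assigns to each pair $(t,s)$, $1\le s\le t\le n$, a probability of making an offer to the $t$-th candidate if time $t$ is reached and $r_t=s$. Each candidate accepts an offer independently with probability $p$; an accepted offer ends the process and the candidate is *collected*, otherwise the process moves on to the next candidate. Let $$\gamma_n^*(p)=\sup_{\mathcal P}\ \min_{1\le k\le n}\ \frac{\Pr(\mathcal P\text{ collects a candidate of overall rank at most }k)}{\Pr(\text{at least one of the }k\text{ best candidates would accept an offer})}.$$ **Continuous linear program.** For $p\in(0,1]$, a pair $(\alpha,\gamma)$ with $\gamma\ge 0$ and $\alpha:[0,1]\times\{1,2,\dots\}\to[0,\infty)$ measurable in its first variable is *feasible* for $(CLP)_p$ if $$t\,\alpha(t,s)\le 1-p\int_0^t\sum_{\sigma\ge1}\alpha(\tau,\sigma)\,d\tau\qquad\text{for all }t\in[0,1],\ s\ge1,$$ $$\gamma\le\frac{p}{1-(1-p)^k}\int_0^1\sum_{s\ge1}\alpha(t,s)\sum_{\ell=s}^{k}\binom{\ell-1}{s-1}t^s(1-t)^{\ell-s}\,dt\qquad\text{for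 all }k\ge1 .$$ Let $\gamma_\infty^*(p)$ be the supremum of $\gamma$ over all feasible pairs $(\alpha,\gamma)$. **Theorem.** The equation $p^{(2-p)/(1-p)}=(1-p)^2$ has exactly one solution $p^*$ in $(0,1)$; it satisfies $0.594<p^*<0.595$, and $0.466<(p^*)^{p^*/(1-p^*)}<0.467$. (a) Let $p^*\le p\le 1$, where for $p=1$ the expressions $p^{1/(1-p)}$ and $p^{p/(1-p)}$ stand for their limit $1/e$. Put $t_1=p^{1/(1-p)}$, and let $\alpha(t,1)=p^{p/(1-p)}/t^{1+p}$ for $t\in[t_1,1]$ and $\alpha(t,s)=0$ otherwise. Then $(\alpha,p^{p/(1-p)})$ is feasible for $(CLP)_p$, and $\gamma_\infty^*(p)=p^{p/(1-p)}$. Moreover $\gamma_n^*(p)\ge\gamma_\infty^*(p)$ for all $n\ge1$, and $\lim_{n\to\infty}\gamma_n^*(p)=\gamma_\infty^*(p)$. (b) Let $0<p\le p^*$. Then $\gamma_\infty^*(p)\ge(p^*)^{p^*/(1-p^*)}$, and $\gamma_n^*(p)\ge(p^*)^{p^*/(1-p^*)}$ for all $n\ge1$. -/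

import Mathlib

open Filter Topology MeasureTheory

noncomputable section

namespace SPUA

/-! ### The secretary problem with uncertain acceptance, `n` candidates

Positions in the sequence and overall ranks are both indexed by `Fin n`, starting at `0`
(overall rank `0` is the best candidate); the partial rank and the time handed to a policy
start at `1`. -/

/-- One realization of the randomness. -/
structure Outcome (n : ℕ) where
  /-- `rank t` is the overall rank of the candidate in position `t`. -/
  rank : Equiv.Perm (Fin n)
  /-- `accepts t` says whether the candidate in position `t` would accept an offer. -/
  accepts : Fin n → Bool
  /-- `offers t` is the policy's own coin for position `t`: if position `t` is reached, the
  candidate there receives an offer exactly when it is `true`. -/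
  offers : Fin n → Bool
deriving Fintype

/-- The partial rank, in `{1, …, t}`, of a candidate among those seen so far. -/
def partialRank {n : ℕ} (rank : Equiv.Perm (Fin n)) (t : Fin n) : ℕ :=
  (Finset.univ.filter fun u : Fin n => u ≤ t ∧ rank u ≤ rank t).card

/-- A randomized policy: `P t s` is the probability of making an offer to the `t`-th candidate
when her partial rank is `s`. Only the values with `1 ≤ s ≤ t ≤ n` matter. -/
abbrev Policy : Type := ℕ → ℕ → unitInterval

/-- The probability of an outcome: the permutation is uniform, each candidate accepts
independently with probability `p`, and, given the permutation, the coins of the policy are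
independent with the biases that the policy prescribes in the states `(t, r_t)`. -/
def outcomeProb {n : ℕ} (p : ℝ) (P : Policy) (ω : Outcome n) : ℝ :=
  ((n.factorial : ℝ))⁻¹ *
    (∏ t : Fin n, if ω.accepts t then p else 1 - p) *
    ∏ t : Fin n, if ω.offers t then (P ((t : ℕ) + 1) (partialRank ω.rank t) : ℝ)
      else 1 - (P ((t : ℕ) + 1) (partialRank ω.rank t) : ℝ)

open Classical in
/-- The probability of an event. -/
def prob {n : ℕ} (p : ℝ) (P : Policy) (E : Outcome n → Prop) : ℝ :=
  ∑ ω : Outcome n, if E ω then outcomeProb p P ω else 0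

/-- The policy collects the candidate in position `t`: the position is reached, i.e. no earlier
offer was made and accepted, an offer is made there, and it is accepted. -/
def CollectsAt {n : ℕ} (ω : Outcome n) (t : Fin n) : Prop :=
  (∀ u < t, ¬ (ω.offers u = true ∧ ω.accepts u = true)) ∧
    ω.offers t = true ∧ ω.accepts t = true

/-- The policy collects one of the `k` best candidates. -/
def CollectsTop {n : ℕ} (k : ℕ) (ω : Outcome n) : Prop :=
  ∃ t : Fin n, (ω.rank t : ℕ) < k ∧ CollectsAt ω t

/-- At least one of the `k` best candidates would accept an offer. -/
def SomeTopAccepts {n : ℕ} (k : ℕ) (ω : Outcome n) : Prop :=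
  ∃ t : Fin n, (ω.rank t : ℕ) < k ∧ ω.accepts t = true

/-- The robust ratio of a policy, the minimum over `1 ≤ k ≤ n`. -/
def robustRatio (n : ℕ) (p : ℝ) (P : Policy) : ℝ :=
  ⨅ k : Fin n, prob (n := n) p P (CollectsTop ((k : ℕ) + 1)) /
    prob (n := n) p P (SomeTopAccepts ((k : ℕ) + 1))

/-- The optimal robust ratio with `n` candidates. -/
def gammaN (n : ℕ) (p : ℝ) : ℝ := ⨆ P : Policy, robustRatio n p P

/-! ### The continuous linear program -/

/-- Feasibility of `(α, γ)` for the continuous linear program with parameter `p`. Only the values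
`α t s` with `t ∈ [0, 1]` and `s ≥ 1` matter. The dynamic constraint
`t α(t, s) ≤ 1 - p ∫₀ᵗ ∑_{σ ≥ 1} α(τ, σ) dτ` is written in `[0, ∞]`, so that it contains the
finiteness of the integral. -/
structure CLPFeasible (p : ℝ) (α : ℝ → ℕ → ℝ) (γ : ℝ) : Prop where
  measurable : ∀ s : ℕ, 1 ≤ s → Measurable fun t => α t s
  nonneg : ∀ t ∈ Set.Icc (0 : ℝ) 1, ∀ s : ℕ, 1 ≤ s → 0 ≤ α t s
  gamma_nonneg : 0 ≤ γ
  dynamic : ∀ t ∈ Set.Icc (0 : ℝ) 1, ∀ s : ℕ, 1 ≤ s →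
    ENNReal.ofReal (t * α t s) +
      ENNReal.ofReal p * ∫⁻ τ in Set.Icc (0 : ℝ) t, ∑' σ : ℕ, ENNReal.ofReal (α τ (σ + 1)) ≤ 1
  objective : ∀ k : ℕ, 1 ≤ k →
    γ ≤ p * (∫ t in (0 : ℝ)..1, ∑ s ∈ Finset.Icc 1 k, α t s *
        ∑ l ∈ Finset.Icc s k, ((l - 1).choose (s - 1) : ℝ) * t ^ s * (1 - t) ^ (l - s)) /
      (1 - (1 - p) ^ k)

/-- The value of the continuous linear program. -/
def gammaInf (p : ℝ) : ℝ := sSup {γ : ℝ | ∃ α : ℝ → ℕ → ℝ, CLPFeasible p α γ}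

/-- `p ^ (1 / (1 - p))`, with its limit `1 / e` at `p = 1`. -/
def cutoff (p : ℝ) : ℝ := if p = 1 then Real.exp (-1) else p ^ (1 / (1 - p))

/-- `p ^ (p / (1 - p))`, with its limit `1 / e` at `p = 1`. -/
def ratioValue (p : ℝ) : ℝ := if p = 1 then Real.exp (-1) else p ^ (p / (1 - p))

/-- The threshold solution: offers only to candidates of partial rank `1`, and only from time
`cutoff p` on. -/
def thresholdSolution (p : ℝ) (t : ℝ) (s : ℕ) : ℝ :=
  if s = 1 ∧ cutoff p ≤ t then ratioValue p / t ^ (1 + p) else 0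

end SPUA

end

noncomputable section

namespace SPUA

/-! ### Uniform permutations -/

/-! Lower bounds: feasible solutions of the continuous program transfer to `n` candidates without
loss. Think of the candidates as arriving at independent uniform times. Integrating `α` against
binomial masses (`discretized`) gives numbers satisfying the finite dynamic constraint, because its
left side is at most the continuous one averaged over the density of an order statistic
(`discretized_dynamic`). The objective is reproduced exactly, by the binomial theorem
(`objective_kernel_eq`). Independence of the partial ranks and the hypergeometric law of the number
of better predecessors give a formula for what a policy collects (`prob_collectsTop`), and
`exists_policy` turns the numbers into conditional offer probabilities.

Upper bound: only `k = 1` is needed. Collecting the best candidate is a linear program whose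
continuous dual has an explicit solution, a weight that vanishes before the cutoff and has total
mass `ratioValue p`. This weight is monotone, so sampling it on a grid costs at most `1 / n`
(`sum_le_of_dynamic`). Together with the lower bound and `n → ∞`, this bounds the continuous program
as well.

Feasibility of the threshold solution: `t ^ (-p)` is a probability density on `[cutoff p, 1]`, and
the constraint for `k` follows term by term from `∫ t ^ (-p) * (1 - t) ^ a ≥ (1 - p) ^ a`. By Jensen
this holds when the mean of the density is at most `p`, that is, when `(1 - p) ^ 2 ≤ cutoff p ^ (2 -
p)`, which is the condition `p^* ≤ p`. For `p ≤ p^*` write `p = ρ * p^*` and read an acceptance as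
"retained with probability `ρ`, then accepting with probability `p^*`". The weight `(1 - ρ) ^ (s -
1)` on partial rank `s` is the chance that all `s - 1` better candidates are discarded. The same
computation with `1 - ρ * t` in place of `1 - t` gives the value at `p^*`
(`thinnedThreshold_feasible`). -/

theorem sum_perm_mul_right {n : ℕ} (g : Equiv.Perm (Fin n)) (F : Equiv.Perm (Fin n) → ℝ) :
    ∑ ρ, F (ρ * g) = ∑ ρ, F ρ :=
  Fintype.sum_equiv (Equiv.mulRight g) _ _ fun _ => rfl

theorem card_filter_mul_perm {n : ℕ} (A B : Fin n → Prop) [DecidablePred A] [DecidablePred B]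
    (g : Equiv.Perm (Fin n)) (hA : ∀ u, A (g u) ↔ A u) :
    (Finset.univ.filter fun u => A u ∧ B (g u)).card =
      (Finset.univ.filter fun u => A u ∧ B u).card := by
  apply Finset.card_bij (fun u _ => g u)
  · intro u hu
    simp only [Finset.mem_filter, Finset.mem_univ, true_and] at hu ⊢
    exact ⟨(hA u).2 hu.1, hu.2⟩
  · intro u _ v _ h
    exact g.injective h
  · intro v hv
    simp only [Finset.mem_filter, Finset.mem_univ, true_and] at hv
    refine ⟨g.symm v, ?_, by simp⟩
    simp only [Finset.mem_filter, Finset.mem_univ, true_and, Equiv.apply_symm_apply]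
    exact ⟨(hA _).1 (by simpa using hv.1), hv.2⟩

theorem swap_lt_iff {n : ℕ} {i j : Fin n} {t : ℕ} (hi : (i : ℕ) < t) (hj : (j : ℕ) < t)
    (u : Fin n) : ((Equiv.swap i j u : Fin n) : ℕ) < t ↔ (u : ℕ) < t := by
  by_cases h1 : u = i
  · subst h1; simp [hi, hj]
  · by_cases h2 : u = j
    · subst h2; simp [hi, hj]
    · rw [Equiv.swap_apply_of_ne_of_ne h1 h2]

/-- A partial rank sees the earlier candidates only as a set. This invariance is the source of the
independence of partial ranks. -/
theorem partialRank_mul_swap_of_lt {n : ℕ} (ρ : Equiv.Perm (Fin n)) {t i j : Fin n}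
    (hi : i < t) (hj : j < t) : partialRank (ρ * Equiv.swap i j) t = partialRank ρ t := by
  have ht : Equiv.swap i j t = t := Equiv.swap_apply_of_ne_of_ne hi.ne' hj.ne'
  unfold partialRank
  simp only [Equiv.Perm.mul_apply, ht]
  refine card_filter_mul_perm (fun u : Fin n => u ≤ t) (fun u : Fin n => ρ u ≤ ρ t)
    (Equiv.swap i j) fun u => ?_
  have := swap_lt_iff (t := t + 1) (Nat.lt_succ_of_lt hi) (Nat.lt_succ_of_lt hj) u
  exact Nat.lt_succ_iff.symm.trans (this.trans Nat.lt_succ_iff)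

/-- Moving the candidate in position `i` to position `t` turns her rank among those in positions
up to `t` into the partial rank there. -/
theorem partialRank_mul_swap_self {n : ℕ} (ρ : Equiv.Perm (Fin n)) {t i : Fin n} (hi : i ≤ t) :
    partialRank (ρ * Equiv.swap i t) t =
      (Finset.univ.filter fun u : Fin n => u ≤ t ∧ ρ u ≤ ρ i).card := by
  unfold partialRank
  simp only [Equiv.Perm.mul_apply, Equiv.swap_apply_right]
  refine card_filter_mul_perm (fun u : Fin n => u ≤ t) (fun u : Fin n => ρ u ≤ ρ i)
    (Equiv.swap i t) fun u => ?_
  have := swap_lt_iff (t := t + 1) (Nat.lt_succ_of_le hi) (Nat.lt_succ_self t) u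
  exact Nat.lt_succ_iff.symm.trans (this.trans Nat.lt_succ_iff)

/-- The relative ranks of the first `t + 1` candidates are distinct and lie in `{1, …, t + 1}`, so
each value occurs once. -/
theorem sum_rank_among {n : ℕ} (ρ : Equiv.Perm (Fin n)) (t : Fin n) (f : ℕ → ℝ) :
    ∑ i ∈ Finset.Iic t, f (Finset.univ.filter fun u : Fin n => u ≤ t ∧ ρ u ≤ ρ i).card =
      ∑ s ∈ Finset.range (t + 1), f (s + 1) := by
  set c : Fin n → ℕ := fun i => (Finset.univ.filter fun u : Fin n => u ≤ t ∧ ρ u ≤ ρ i).card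
    with hc
  have hmono : ∀ i ∈ Finset.Iic t, ∀ j ∈ Finset.Iic t, ρ i < ρ j → c i < c j := by
    intro i _ j hj hij
    apply Finset.card_lt_card
    rw [Finset.ssubset_iff_of_subset]
    · exact ⟨j, by simpa using hj, by simp [hij]⟩
    · intro u hu
      simp only [Finset.mem_filter, Finset.mem_univ, true_and] at hu ⊢
      exact ⟨hu.1, hu.2.trans hij.le⟩
  have hinj : Set.InjOn c (Finset.Iic t) := by
    intro i hi j hj hij
    rcases lt_trichotomy (ρ i) (ρ j) with h | h | h
    · exact absurd hij (hmono i hi j hj h).ne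
    · exact ρ.injective h
    · exact absurd hij (hmono j hj i hi h).ne'
  have himg : (Finset.Iic t).image c = Finset.Icc 1 ((t : ℕ) + 1) := by
    apply Finset.eq_of_subset_of_card_le
    · intro x hx
      obtain ⟨i, hi, rfl⟩ := Finset.mem_image.1 hx
      rw [Finset.mem_Icc]
      constructor
      · exact Finset.card_pos.2 ⟨i, by simpa using hi⟩
      · calc c i ≤ (Finset.Iic t).card := Finset.card_le_card (by intro u; simp; tauto)
          _ = t + 1 := by simp
    · rw [Finset.card_image_of_injOn hinj]; simp
  rw [← Finset.sum_image (f := f) hinj, himg, Finset.range_eq_Ico, Finset.sum_Ico_add' f 0 _ 1]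
  rfl

/-- Average over the candidate `i ≤ t` that is moved to position `t`: `G` does not notice the swap,
and the resulting partial ranks run once through `{1, …, t + 1}`. -/
theorem sum_partialRank_mul {n : ℕ} (t : Fin n) (f : ℕ → ℝ) (G : Equiv.Perm (Fin n) → ℝ)
    (hG : ∀ i ≤ t, ∀ ρ, G (ρ * Equiv.swap i t) = G ρ) :
    ∑ ρ, f (partialRank ρ t) * G ρ =
      (∑ s ∈ Finset.range (t + 1), f (s + 1)) / ((t : ℝ) + 1) * ∑ ρ, G ρ := by
  have key : ∀ i ∈ Finset.Iic t, ∑ ρ, f (partialRank ρ t) * G ρ =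
      ∑ ρ, f (Finset.univ.filter fun u : Fin n => u ≤ t ∧ ρ u ≤ ρ i).card * G ρ := by
    intro i hi
    rw [← sum_perm_mul_right (Equiv.swap i t)]
    refine Finset.sum_congr rfl fun ρ _ => ?_
    rw [partialRank_mul_swap_self ρ (by simpa using hi), hG i (by simpa using hi)]
  have h2 := Finset.sum_congr rfl key
  rw [Finset.sum_const, Finset.sum_comm] at h2
  simp only [← Finset.sum_mul, sum_rank_among] at h2
  rw [← Finset.mul_sum] at h2
  have : (0 : ℝ) < (t : ℝ) + 1 := by positivity
  rw [div_mul_eq_mul_div, eq_div_iff this.ne', ← h2]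
  simp [mul_comm]

/-- The partial ranks are independent of each other and of everything that does not depend on
the order of the earlier candidates. -/
theorem sum_prod_partialRank_mul {n : ℕ} (f : ℕ → ℕ → ℝ) (t : ℕ) (ht : t ≤ n)
    (G : Equiv.Perm (Fin n) → ℝ)
    (hG : ∀ i j : Fin n, (i : ℕ) < t → (j : ℕ) < t → ∀ ρ, G (ρ * Equiv.swap i j) = G ρ) :
    ∑ ρ, (∏ u ∈ Finset.univ.filter fun u : Fin n => (u : ℕ) < t, f u (partialRank ρ u)) * G ρ =
      (∏ u ∈ Finset.range t, (∑ s ∈ Finset.range (u + 1), f u (s + 1)) / ((u : ℝ) + 1)) *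
        ∑ ρ, G ρ := by
  induction t generalizing G with
  | zero => simp
  | succ t ih =>
    have hfil : (Finset.univ.filter fun u : Fin n => (u : ℕ) < t + 1) =
        insert ⟨t, ht⟩ (Finset.univ.filter fun u : Fin n => (u : ℕ) < t) := by
      ext u
      simp only [Finset.mem_filter, Finset.mem_univ, true_and, Finset.mem_insert, Fin.ext_iff]
      omega
    rw [hfil]
    simp only [Finset.prod_insert (show (⟨t, ht⟩ : Fin n) ∉
      Finset.univ.filter fun u : Fin n => (u : ℕ) < t by simp)]
    have h1 := ih (by omega) (fun ρ => f t (partialRank ρ ⟨t, ht⟩) * G ρ) (by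
      intro i j hi hj ρ
      rw [partialRank_mul_swap_of_lt ρ (by exact hi) (by exact hj), hG i j (by omega) (by omega)])
    have h2 := sum_partialRank_mul ⟨t, ht⟩ (f t) G (by
      intro i hi ρ
      exact hG _ _ (Nat.lt_succ_of_le hi) (Nat.lt_succ_self t) ρ)
    rw [Finset.prod_range_succ, mul_assoc]
    rw [show (∑ s ∈ Finset.range (t + 1), f t (s + 1)) / ((t : ℝ) + 1) * ∑ ρ, G ρ =
      ∑ ρ, f t (partialRank ρ ⟨t, ht⟩) * G ρ from h2.symm, ← h1]
    refine Finset.sum_congr rfl fun ρ _ => ?_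
    ring

/-- One further draw without replacement from `a` good and `b` bad items. The coefficient of `F m`
collects `m` from the good draws and `t + 1 - m` from the bad ones. -/
theorem choose_hypergeometric_step (a b t : ℕ) (F : ℕ → ℝ) :
    ∑ m ∈ Finset.range (t + 1), (a.choose m : ℝ) * (b.choose (t - m) : ℝ) *
        (((a : ℝ) - m) * F (m + 1) + ((b : ℝ) - (t - m : ℕ)) * F m) =
      ((t : ℝ) + 1) * ∑ m ∈ Finset.range (t + 2),
        (a.choose m : ℝ) * (b.choose (t + 1 - m) : ℝ) * F m := by
  have hc : ∀ c m : ℕ, (c.choose m : ℝ) * ((c : ℝ) - m) = ((m : ℝ) + 1) * c.choose (m + 1) := by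
    intro c m
    rcases le_or_gt m c with h | h
    · have := Nat.choose_succ_right_eq c m
      have h2 : (c.choose (m + 1) : ℝ) * ((m : ℝ) + 1) = c.choose m * ((c - m : ℕ) : ℝ) := by
        exact_mod_cast this
      rw [Nat.cast_sub h] at h2
      linarith
    · rw [Nat.choose_eq_zero_of_lt h, Nat.choose_eq_zero_of_lt (by omega)]; simp
  have h1 : ∀ m ∈ Finset.range (t + 1), (a.choose m : ℝ) * (b.choose (t - m) : ℝ) *
        (((a : ℝ) - m) * F (m + 1) + ((b : ℝ) - (t - m : ℕ)) * F m) =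
      ((m + 1 : ℕ) : ℝ) * (a.choose (m + 1) * (b.choose (t + 1 - (m + 1)) : ℝ) * F (m + 1)) +
      ((t : ℝ) + 1 - m) * (a.choose m * (b.choose (t + 1 - m) : ℝ) * F m) := by
    intro m hm
    have hm' : m ≤ t := Nat.lt_succ_iff.1 (Finset.mem_range.1 hm)
    have e1 := hc a m
    have e2 := hc b (t - m)
    rw [show t - m + 1 = t + 1 - m by omega] at e2
    have e3 : ((t - m : ℕ) : ℝ) + 1 = (t : ℝ) + 1 - m := by rw [Nat.cast_sub hm']; ring
    rw [e3] at e2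
    rw [show t + 1 - (m + 1) = t - m by omega]
    push_cast
    linear_combination (b.choose (t - m) : ℝ) * F (m + 1) * e1 + (a.choose m : ℝ) * F m * e2
  rw [Finset.sum_congr rfl h1, Finset.sum_add_distrib]
  have h2 := Finset.sum_range_succ' (fun m => (m : ℝ) *
    (a.choose m * (b.choose (t + 1 - m) : ℝ) * F m)) (t + 1)
  have h3 := Finset.sum_range_succ (fun m => ((t : ℝ) + 1 - m) *
    (a.choose m * (b.choose (t + 1 - m) : ℝ) * F m)) (t + 1)
  simp only [Nat.cast_zero, zero_mul, add_zero] at h2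
  push_cast at h3
  simp only [sub_self, zero_mul, add_zero] at h3
  rw [← h2, ← h3, ← Finset.sum_add_distrib, Finset.mul_sum]
  exact Finset.sum_congr rfl fun m _ => by ring

theorem card_filter_perm_lt {n : ℕ} (ρ : Equiv.Perm (Fin n)) (a : Fin n) :
    (Finset.univ.filter fun u => ρ u < a).card = a := by
  have := card_filter_mul_perm (fun _ : Fin n => True) (fun u : Fin n => u < a) ρ (by simp)
  simp only [true_and] at this
  rw [this, show (Finset.univ.filter fun u : Fin n => u < a) = Finset.Iio a by ext; simp]
  simp

/-- The number of candidates better than the one of rank `a` among the first `t` is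
hypergeometric. -/
theorem sum_card_better {n : ℕ} (a p : Fin n) (t : ℕ) (ht : t ≤ p) (F : ℕ → ℝ) :
    ∑ ρ : Equiv.Perm (Fin n), (if ρ p = a then
        F (Finset.univ.filter fun u : Fin n => (u : ℕ) < t ∧ ρ u < a).card else 0) =
      ((n - 1).factorial : ℝ) * ∑ m ∈ Finset.range (t + 1), ((a : ℕ).choose m : ℝ) *
        ((n - 1 - a).choose (t - m) : ℝ) / ((n - 1).choose t : ℝ) * F m := by
  induction t generalizing F with
  | zero =>
    have hcard : ((Finset.univ.filter fun ρ : Equiv.Perm (Fin n) => ρ p = a).card : ℝ) =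
        ((n - 1).factorial : ℝ) := by
      have h1 : ∀ b : Fin n, (Finset.univ.filter fun ρ : Equiv.Perm (Fin n) => ρ p = b).card =
          (Finset.univ.filter fun ρ : Equiv.Perm (Fin n) => ρ p = a).card := by
        intro b
        apply Finset.card_bij (fun ρ _ => Equiv.swap a b * ρ)
        · intro ρ hρ
          have : ρ p = b := by simpa using hρ
          simp [this]
        · intro ρ _ σ _ h
          exact mul_left_cancel h
        · intro σ hσ
          have : σ p = a := by simpa using hσ
          exact ⟨Equiv.swap a b * σ, by simp [this], by simp [← mul_assoc]⟩
      have h2 := Finset.card_eq_sum_card_fiberwise (s := Finset.univ)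
        (t := (Finset.univ : Finset (Fin n))) (f := fun ρ : Equiv.Perm (Fin n) => ρ p) (by simp)
      rw [Finset.sum_congr rfl fun b _ => h1 b, Finset.sum_const, Finset.card_univ,
        Finset.card_univ, Fintype.card_perm, Fintype.card_fin, smul_eq_mul] at h2
      have hn : 0 < n := Fin.pos a
      rw [← Nat.mul_factorial_pred hn.ne'] at h2
      exact_mod_cast (Nat.eq_of_mul_eq_mul_left hn h2).symm
    simp only [Nat.not_lt_zero, false_and, Finset.filter_false, Finset.card_empty]
    rw [← Finset.sum_filter, Finset.sum_const, nsmul_eq_mul, hcard]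
    simp
  | succ t ih =>
    have htn : t < n := by omega
    set T : Fin n := ⟨t, htn⟩ with hT
    have hTp : T ≠ p := by intro h; rw [← h] at ht; simp [hT] at ht
    set μ : Equiv.Perm (Fin n) → ℕ := fun ρ =>
      (Finset.univ.filter fun u : Fin n => (u : ℕ) < t ∧ ρ u < a).card with hμ
    set I : Finset (Fin n) := Finset.univ.filter fun i => t ≤ (i : ℕ) ∧ i ≠ p with hI
    have hfil : ∀ ρ : Equiv.Perm (Fin n),
        (Finset.univ.filter fun u : Fin n => (u : ℕ) < t + 1 ∧ ρ u < a).card =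
          μ ρ + if ρ T < a then 1 else 0 := by
      intro ρ
      have : (Finset.univ.filter fun u : Fin n => (u : ℕ) < t + 1 ∧ ρ u < a) =
          (Finset.univ.filter fun u : Fin n => (u : ℕ) < t ∧ ρ u < a) ∪
          (if ρ T < a then {T} else ∅) := by
        ext u
        by_cases hu : u = T
        · have hTt : (T : ℕ) = t := rfl
          rw [hu]; by_cases h : ρ T < a <;> simp [h, hTt]
        · have hu' : (u : ℕ) ≠ t := fun h => hu (Fin.ext h)
          by_cases h : ρ T < a <;> simp [h, hu] <;> omega
      rw [this, Finset.card_union_of_disjoint]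
      · congr 1; split_ifs <;> simp
      · rw [Finset.disjoint_left]
        intro u hu
        have : (u : ℕ) < t := (Finset.mem_filter.1 hu).2.1
        split_ifs
        · rw [Finset.mem_singleton]; rintro rfl; simp [hT] at this
        · simp
    have hIcard : (I.card : ℝ) = (n : ℝ) - 1 - t := by
      have h1 : I = (Finset.Ici T).erase p := by
        ext i; simp [hI, hT, Fin.le_def, and_comm]
      rw [h1, Finset.card_erase_of_mem (by simp [Fin.le_def, hT]; omega), Fin.card_Ici]
      simp only [hT]
      rw [Nat.cast_sub (by omega), Nat.cast_sub (by omega)]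
      push_cast; ring
    -- The next draw may come from any position from `t` on other than `p`: swapping it with `T`
    -- disturbs neither the first `t` positions nor position `p`.
    have hswap : ∀ i ∈ I,
        ∑ ρ : Equiv.Perm (Fin n), (if ρ p = a then F (μ ρ + if ρ T < a then 1 else 0) else 0) =
        ∑ ρ : Equiv.Perm (Fin n), (if ρ p = a then F (μ ρ + if ρ i < a then 1 else 0) else 0) := by
      intro i hi
      have hi' : t ≤ (i : ℕ) ∧ i ≠ p := by simpa [hI] using hi
      rw [← sum_perm_mul_right (Equiv.swap T i)]
      refine Finset.sum_congr rfl fun ρ _ => ?_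
      have h1 : (ρ * Equiv.swap T i) p = ρ p := by
        rw [Equiv.Perm.mul_apply, Equiv.swap_apply_of_ne_of_ne hTp.symm hi'.2.symm]
      have h2 : μ (ρ * Equiv.swap T i) = μ ρ := by
        simp only [hμ]
        congr 1
        refine Finset.filter_congr fun u _ => and_congr_right fun hu => ?_
        rw [Equiv.Perm.mul_apply, Equiv.swap_apply_of_ne_of_ne]
        · rintro rfl; simp [hT] at hu
        · rintro rfl; omega
      rw [h1, h2, Equiv.Perm.mul_apply, Equiv.swap_apply_left]
    have hcount : ∀ ρ : Equiv.Perm (Fin n), ρ p = a →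
        ∑ i ∈ I, F (μ ρ + if ρ i < a then 1 else 0) =
          ((a : ℝ) - μ ρ) * F (μ ρ + 1) + (((n : ℝ) - 1 - t) - ((a : ℝ) - μ ρ)) * F (μ ρ) := by
      intro ρ hρ
      have hcnt : ((I.filter fun i => ρ i < a).card : ℝ) = (a : ℝ) - μ ρ := by
        rw [eq_sub_iff_add_eq]
        have h := card_filter_perm_lt ρ a
        have hd : (Finset.univ.filter fun u => ρ u < a) = (I.filter fun i => ρ i < a) ∪
            (Finset.univ.filter fun u : Fin n => (u : ℕ) < t ∧ ρ u < a) := by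
          ext u
          simp only [hI, Finset.mem_filter, Finset.mem_univ, true_and, Finset.mem_union]
          constructor
          · intro hu
            have hup : u ≠ p := by rintro rfl; rw [hρ] at hu; exact lt_irrefl _ hu
            rcases le_or_gt t (u : ℕ) with h | h
            · exact Or.inl ⟨⟨h, hup⟩, hu⟩
            · exact Or.inr ⟨h, hu⟩
          · tauto
        rw [hd, Finset.card_union_of_disjoint] at h
        · exact_mod_cast h
        · rw [Finset.disjoint_left]
          intro u hu hu'
          simp only [hI, Finset.mem_filter, Finset.mem_univ, true_and] at hu hu'
          omega
      have hcnt' : ((I.filter fun i => ¬ ρ i < a).card : ℝ) =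
          ((n : ℝ) - 1 - t) - ((a : ℝ) - μ ρ) := by
        rw [← hcnt, ← hIcard, eq_sub_iff_add_eq, add_comm]
        exact_mod_cast Finset.card_filter_add_card_filter_not (s := I) (fun i => ρ i < a)
      rw [← Finset.sum_filter_add_sum_filter_not I (fun i => ρ i < a), ← hcnt', ← hcnt]
      congr 1
      · rw [← nsmul_eq_mul, ← Finset.sum_const]
        exact Finset.sum_congr rfl fun i hi => by rw [if_pos (Finset.mem_filter.1 hi).2]
      · rw [← nsmul_eq_mul, ← Finset.sum_const]
        exact Finset.sum_congr rfl fun i hi => by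
          rw [if_neg (Finset.mem_filter.1 hi).2, add_zero]
    have hNt : (0 : ℝ) < (n : ℝ) - 1 - t := by
      have : (t : ℝ) + 1 < n := by exact_mod_cast (show t + 1 < n by omega)
      linarith
    have hsum := Finset.sum_congr rfl hswap
    rw [Finset.sum_const, Finset.sum_comm, nsmul_eq_mul, hIcard] at hsum
    have hstep : ∑ ρ : Equiv.Perm (Fin n), ∑ i ∈ I,
        (if ρ p = a then F (μ ρ + if ρ i < a then 1 else 0) else 0) =
        ∑ ρ : Equiv.Perm (Fin n), (if ρ p = a then ((fun m : ℕ => ((a : ℝ) - m) * F (m + 1) +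
          (((n : ℝ) - 1 - t) - ((a : ℝ) - m)) * F m) (μ ρ)) else 0) := by
      refine Finset.sum_congr rfl fun ρ _ => ?_
      split_ifs with h
      · exact hcount ρ h
      · simp
    rw [hstep, ih (by omega) (fun m : ℕ => ((a : ℝ) - m) * F (m + 1) +
          (((n : ℝ) - 1 - t) - ((a : ℝ) - m)) * F m)] at hsum
    simp only [hfil]
    have han : (a : ℕ) ≤ n - 1 := by omega
    have hb : ((n - 1 - a : ℕ) : ℝ) = (n : ℝ) - 1 - a := by
      rw [Nat.cast_sub han, Nat.cast_sub (by omega)]; simp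
    have hch : ((n - 1).choose t : ℝ) * ((n : ℝ) - 1 - t) =
        ((t : ℝ) + 1) * ((n - 1).choose (t + 1) : ℝ) := by
      have := Nat.choose_succ_right_eq (n - 1) t
      have h2 : ((n - 1).choose (t + 1) : ℝ) * ((t : ℝ) + 1) =
          (n - 1).choose t * ((n - 1 - t : ℕ) : ℝ) := by exact_mod_cast this
      rw [Nat.cast_sub (by omega), Nat.cast_sub (by omega)] at h2
      push_cast at h2
      linarith
    have hc0 : (0 : ℝ) < ((n - 1).choose t : ℝ) := by exact_mod_cast Nat.choose_pos (by omega)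
    have hc1 : (0 : ℝ) < ((n - 1).choose (t + 1) : ℝ) := by
      exact_mod_cast Nat.choose_pos (by omega)
    have hmain := choose_hypergeometric_step a (n - 1 - a) t F
    have e1 : ∑ m ∈ Finset.range (t + 1), ((a : ℕ).choose m : ℝ) *
        ((n - 1 - a).choose (t - m) : ℝ) / ((n - 1).choose t : ℝ) * (((a : ℝ) - m) * F (m + 1) +
          (((n : ℝ) - 1 - t) - ((a : ℝ) - m)) * F m) =
        (∑ m ∈ Finset.range (t + 1), ((a : ℕ).choose m : ℝ) *
        ((n - 1 - a).choose (t - m) : ℝ) * (((a : ℝ) - m) * F (m + 1) +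
          (((n - 1 - a : ℕ) : ℝ) - (t - m : ℕ)) * F m)) / ((n - 1).choose t : ℝ) := by
      rw [Finset.sum_div]
      refine Finset.sum_congr rfl fun m hm => ?_
      have hm' : m ≤ t := Nat.lt_succ_iff.1 (Finset.mem_range.1 hm)
      rw [hb, Nat.cast_sub hm']
      ring
    rw [e1, hmain] at hsum
    rw [← mul_right_inj' hNt.ne', hsum]
    have e2 : ∑ m ∈ Finset.range (t + 1 + 1), ((a : ℕ).choose m : ℝ) *
        ((n - 1 - a).choose (t + 1 - m) : ℝ) / ((n - 1).choose (t + 1) : ℝ) * F m =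
        (∑ m ∈ Finset.range (t + 2), ((a : ℕ).choose m : ℝ) *
        ((n - 1 - a).choose (t + 1 - m) : ℝ) * F m) / ((n - 1).choose (t + 1) : ℝ) := by
      rw [Finset.sum_div]
      exact Finset.sum_congr rfl fun m _ => by ring
    rw [e2]
    field_simp
    linear_combination (-(∑ m ∈ Finset.range (t + 2),
      ((a : ℕ).choose m : ℝ) * ((n - 1 - a).choose (t + 1 - m) : ℝ) * F m)) * hch

/-! ### The finite model -/

/-- An outcome is a permutation together with two coins for each position. -/
def Outcome.equivProd (n : ℕ) : Outcome n ≃ Equiv.Perm (Fin n) × (Fin n → Bool × Bool) where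
  toFun ω := (ω.rank, fun t => (ω.accepts t, ω.offers t))
  invFun x := ⟨x.1, fun t => (x.2 t).1, fun t => (x.2 t).2⟩
  left_inv _ := rfl
  right_inv _ := rfl

/-- The probability of a pair of coins (acceptance, offer). -/
def coinWeight (p x : ℝ) (b : Bool × Bool) : ℝ :=
  (if b.1 then p else 1 - p) * if b.2 then x else 1 - x

/-- Given the permutation, the coins at different positions are independent, so an event that is a
conjunction over positions has a product as its conditional probability. -/
theorem prob_of_forall {n : ℕ} (p : ℝ) (P : Policy) (E : Outcome n → Prop)
    (A : Equiv.Perm (Fin n) → Prop) (Q : Equiv.Perm (Fin n) → Fin n → Bool × Bool → Prop)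
    [DecidablePred A] [∀ ρ t, DecidablePred (Q ρ t)]
    (h : ∀ ω, E ω ↔ A ω.rank ∧ ∀ t, Q ω.rank t (ω.accepts t, ω.offers t)) :
    prob p P E = ((n.factorial : ℝ))⁻¹ * ∑ ρ : Equiv.Perm (Fin n), if A ρ then
      ∏ t, ∑ b : Bool × Bool,
        (if Q ρ t b then coinWeight p (P ((t : ℕ) + 1) (partialRank ρ t)) b else 0) else 0 := by
  unfold prob
  rw [← Equiv.sum_comp (Outcome.equivProd n).symm, Fintype.sum_prod_type, Finset.mul_sum]
  refine Finset.sum_congr rfl fun ρ _ => ?_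
  by_cases hA : A ρ
  · rw [if_pos hA, Finset.prod_univ_sum, Fintype.piFinset_univ, Finset.mul_sum]
    refine Finset.sum_congr rfl fun c _ => ?_
    by_cases hQ : ∀ t, Q ρ t (c t)
    · rw [if_pos ((h _).2 ⟨hA, hQ⟩)]
      simp only [hQ, if_true, outcomeProb, Outcome.equivProd, coinWeight,
        Finset.prod_mul_distrib, Equiv.coe_fn_symm_mk, mul_assoc]
      rfl
    · rw [if_neg fun hE => hQ ((h _).1 hE).2]
      push Not at hQ
      obtain ⟨t, ht⟩ := hQ
      rw [Finset.prod_eq_zero (Finset.mem_univ t) (if_neg ht), mul_zero]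
  · rw [if_neg hA, mul_zero]
    exact Finset.sum_eq_zero fun c _ => if_neg fun hE => hA ((h _).1 hE).1

theorem prob_true {n : ℕ} (p : ℝ) (P : Policy) : prob (n := n) p P (fun _ => True) = 1 := by
  classical
  rw [prob_of_forall p P _ (fun _ => True) (fun _ _ _ => True) (by simp)]
  simp only [if_true, Fintype.sum_prod_type, Fintype.sum_bool, coinWeight]
  have : ∀ x : ℝ, p * x + p * (1 - x) + ((1 - p) * x + (1 - p) * (1 - x)) = 1 := by
    intro x; ring
  simp only [Bool.false_eq_true, if_false, this, Finset.prod_const_one, Finset.sum_const,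
    Finset.card_univ, Fintype.card_perm, Fintype.card_fin, nsmul_eq_mul, mul_one]
  exact inv_mul_cancel₀ (by exact_mod_cast n.factorial_ne_zero)

theorem prob_add_prob_not {n : ℕ} (p : ℝ) (P : Policy) (E : Outcome n → Prop) :
    prob p P E + prob p P (fun ω => ¬ E ω) = 1 := by
  rw [← prob_true (n := n) p P]
  unfold prob
  rw [← Finset.sum_add_distrib]
  refine Finset.sum_congr rfl fun ω _ => ?_
  by_cases h : E ω <;> simp [h]

theorem prob_someTopAccepts {n : ℕ} (p : ℝ) (P : Policy) (k : ℕ) (hk : k ≤ n) :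
    prob (n := n) p P (SomeTopAccepts k) = 1 - (1 - p) ^ k := by
  classical
  suffices h : prob (n := n) p P (fun ω => ¬ SomeTopAccepts k ω) = (1 - p) ^ k by
    rw [← h, eq_sub_iff_add_eq, prob_add_prob_not]
  rw [prob_of_forall p P _ (fun _ => True) (fun ρ t b => (ρ t : ℕ) < k → b.1 = false)
    (by intro ω; simp only [SomeTopAccepts, not_exists, not_and, Bool.not_eq_true, true_and])]
  have hcoin : ∀ (ρ : Equiv.Perm (Fin n)) (t : Fin n) (x : ℝ), ∑ b : Bool × Bool,
      (if ((ρ t : ℕ) < k → b.1 = false) then coinWeight p x b else 0) =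
      if (ρ t : ℕ) < k then 1 - p else 1 := by
    intro ρ t x
    by_cases h : (ρ t : ℕ) < k
    · simp [h, Fintype.sum_prod_type, coinWeight]; ring
    · simp [h, Fintype.sum_prod_type, coinWeight]; ring
  have hprod : ∀ ρ : Equiv.Perm (Fin n),
      ∏ t, (if (ρ t : ℕ) < k then 1 - p else 1) = (1 - p) ^ k := by
    intro ρ
    rw [Equiv.prod_comp ρ (fun a : Fin n => if (a : ℕ) < k then 1 - p else 1),
      Fin.prod_univ_eq_prod_range (fun a => if a < k then 1 - p else 1) n,
      ← Finset.prod_filter, Finset.prod_const]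
    congr 1
    rw [show (Finset.range n).filter (· < k) = Finset.range k by ext; simp; omega]
    simp
  simp only [hcoin, hprod, if_true, Finset.sum_const, Finset.card_univ, Fintype.card_perm,
    Fintype.card_fin, nsmul_eq_mul]
  rw [inv_mul_cancel_left₀ (by exact_mod_cast n.factorial_ne_zero)]

/-! ### Collection probabilities of a policy -/

theorem CollectsAt.unique {n : ℕ} {ω : Outcome n} {t u : Fin n} (ht : CollectsAt ω t)
    (hu : CollectsAt ω u) : t = u := by
  rcases lt_trichotomy t u with h | h | h
  · exact absurd ht.2 (hu.1 t h)
  · exact h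
  · exact absurd hu.2 (ht.1 u h)

open Classical in
theorem prob_collectsTop_eq_sum {n : ℕ} (p : ℝ) (P : Policy) (k : ℕ) :
    prob (n := n) p P (CollectsTop k) =
      ∑ t : Fin n, prob p P (fun ω => (ω.rank t : ℕ) < k ∧ CollectsAt ω t) := by
  unfold prob
  rw [Finset.sum_comm]
  refine Finset.sum_congr rfl fun ω _ => ?_
  by_cases h : CollectsTop k ω
  · rw [if_pos h]
    obtain ⟨t, ht⟩ := h
    rw [Finset.sum_eq_single t, if_pos ht]
    · intro u _ hu
      exact if_neg fun hc => hu (hc.2.unique ht.2)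
    · simp
  · rw [if_neg h]
    exact (Finset.sum_eq_zero fun t _ => if_neg fun ht => h ⟨t, ht⟩).symm

open Classical in
theorem prob_collectsAt {n : ℕ} (p : ℝ) (P : Policy) (k : ℕ) (t : Fin n) :
    prob (n := n) p P (fun ω => (ω.rank t : ℕ) < k ∧ CollectsAt ω t) =
      ((n.factorial : ℝ))⁻¹ * ∑ ρ : Equiv.Perm (Fin n),
        (∏ u ∈ Finset.univ.filter fun u : Fin n => (u : ℕ) < t,
          (1 - p * P ((u : ℕ) + 1) (partialRank ρ u))) *
        if (ρ t : ℕ) < k then p * P ((t : ℕ) + 1) (partialRank ρ t) else 0 := by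
  rw [prob_of_forall p P _ (fun ρ => (ρ t : ℕ) < k)
    (fun _ u b => (u < t → ¬ (b.2 = true ∧ b.1 = true)) ∧ (u = t → b.2 = true ∧ b.1 = true))]
  · congr 1
    refine Finset.sum_congr rfl fun ρ _ => ?_
    by_cases hk : (ρ t : ℕ) < k
    swap
    · simp [hk]
    rw [if_pos hk, if_pos hk]
    -- Positions before `t` must not end the process, position `t` must, and later positions are
    -- unconstrained, hence contribute total mass `1`.
    have hcoin : ∀ (u : Fin n) (x : ℝ), ∑ b : Bool × Bool,
        (if (u < t → ¬ (b.2 = true ∧ b.1 = true)) ∧ (u = t → b.2 = true ∧ b.1 = true)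
          then coinWeight p x b else 0) =
        (if (u : ℕ) < t then 1 - p * x else 1) * if u = t then p * x else 1 := by
      intro u x
      rcases lt_trichotomy u t with h | h | h
      · have h' : (u : ℕ) < t := h
        simp [h, h', h.ne, Fintype.sum_prod_type, coinWeight]; ring
      · simp [h, Fintype.sum_prod_type, coinWeight]
      · have h' : ¬ (u : ℕ) < t := h.asymm
        simp [h.asymm, h', h.ne', Fintype.sum_prod_type, coinWeight]; ring
    simp only [hcoin]
    rw [Finset.prod_mul_distrib, Finset.prod_ite_eq' Finset.univ t, ← Finset.prod_filter]
    simp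
  · intro ω
    change _ ∧ _ ∧ _ ↔ _
    refine and_congr_right fun _ => ⟨fun h u => ⟨fun hu => h.1 u hu, ?_⟩, fun h =>
      ⟨fun u hu => (h u).1 hu, (h t).2 rfl⟩⟩
    rintro rfl
    exact h.2

/-- The probability that a policy reaches the candidate in position `t`. -/
def reachProb (p : ℝ) (P : Policy) (t : ℕ) : ℝ :=
  ∏ u ∈ Finset.range t, (1 - p / ((u : ℝ) + 1) * ∑ s ∈ Finset.range (u + 1), (P (u + 1) (s + 1) : ℝ))

theorem partialRank_eq_succ {n : ℕ} (ρ : Equiv.Perm (Fin n)) (t : Fin n) :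
    partialRank ρ t =
      (Finset.univ.filter fun u : Fin n => (u : ℕ) < t ∧ ρ u < ρ t).card + 1 := by
  unfold partialRank
  rw [show (Finset.univ.filter fun u : Fin n => u ≤ t ∧ ρ u ≤ ρ t) =
    insert t (Finset.univ.filter fun u : Fin n => (u : ℕ) < t ∧ ρ u < ρ t) from ?_,
    Finset.card_insert_of_notMem (by simp)]
  ext u
  simp only [Finset.mem_filter, Finset.mem_univ, true_and, Finset.mem_insert]
  by_cases h : u = t
  · simp [h]
  · have h1 : u ≤ t ↔ (u : ℕ) < t := (show u ≤ t ↔ u < t from ⟨fun h' => lt_of_le_of_ne h' h, le_of_lt⟩)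
    have h2 : ρ u ≤ ρ t ↔ ρ u < ρ t :=
      ⟨fun h' => lt_of_le_of_ne h' fun e => h (ρ.injective e), le_of_lt⟩
    rw [h1, h2]; simp [h]

/-- The probability of collecting one of the `k` best candidates. -/
theorem prob_collectsTop {n : ℕ} (p : ℝ) (P : Policy) (k : ℕ) (hk : k ≤ n) :
    prob (n := n) p P (CollectsTop k) = ∑ t ∈ Finset.range n, reachProb p P t *
      ∑ a ∈ Finset.range k, ∑ m ∈ Finset.range (t + 1),
        p * P (t + 1) (m + 1) * ((a.choose m : ℝ) * ((n - 1 - a).choose (t - m) : ℝ) /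
          (n * ((n - 1).choose t : ℝ))) := by
  classical
  rw [prob_collectsTop_eq_sum, ← Fin.sum_univ_eq_sum_range (fun t => reachProb p P t *
      ∑ a ∈ Finset.range k, ∑ m ∈ Finset.range (t + 1),
        p * P (t + 1) (m + 1) * ((a.choose m : ℝ) * ((n - 1 - a).choose (t - m) : ℝ) /
          (n * ((n - 1).choose t : ℝ))))]
  refine Finset.sum_congr rfl fun t _ => ?_
  have hn : 0 < n := Fin.pos t
  rw [prob_collectsAt, sum_prod_partialRank_mul (fun u s => 1 - p * P (u + 1) s) t t.2.le]
  swap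
  · intro i j hi hj ρ
    rw [partialRank_mul_swap_of_lt ρ (by exact hi) (by exact hj), Equiv.Perm.mul_apply,
      Equiv.swap_apply_of_ne_of_ne]
    · rintro rfl; exact lt_irrefl _ hi
    · rintro rfl; exact lt_irrefl _ hj
  have hreach : ∏ u ∈ Finset.range t, (∑ s ∈ Finset.range (u + 1),
      (1 - p * (P (u + 1) (s + 1) : ℝ))) / ((u : ℝ) + 1) = reachProb p P t := by
    refine Finset.prod_congr rfl fun u _ => ?_
    rw [Finset.sum_sub_distrib, ← Finset.mul_sum]
    have : (0 : ℝ) < (u : ℝ) + 1 := by positivity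
    simp only [Finset.sum_const, Finset.card_range, nsmul_eq_mul, mul_one]
    push_cast
    field_simp
  rw [hreach, mul_left_comm]
  congr 1
  -- Splitting by the overall rank `a` at position `t` makes the partial rank a count of better
  -- predecessors, to which `sum_card_better` applies.
  have hsplit : ∀ ρ : Equiv.Perm (Fin n),
      (if (ρ t : ℕ) < k then p * (P ((t : ℕ) + 1) (partialRank ρ t) : ℝ) else 0) =
      ∑ a : Fin n, if (a : ℕ) < k then (if ρ t = a then (fun m => p * (P ((t : ℕ) + 1) (m + 1) : ℝ))
        (Finset.univ.filter fun u : Fin n => (u : ℕ) < t ∧ ρ u < a).card else 0) else 0 := by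
    intro ρ
    rw [Finset.sum_eq_single (ρ t)]
    · rw [if_pos rfl, partialRank_eq_succ]
    · intro b _ hb
      rw [if_neg hb.symm, ite_self]
    · simp
  simp only [hsplit]
  rw [Finset.sum_comm]
  set g : ℕ → ℝ := fun a => if a < k then ((n - 1).factorial : ℝ) *
    ∑ m ∈ Finset.range ((t : ℕ) + 1),
        (a.choose m : ℝ) * ((n - 1 - a).choose (t - m) : ℝ) / ((n - 1).choose t : ℝ) *
          (p * (P ((t : ℕ) + 1) (m + 1) : ℝ)) else 0 with hg
  have hinner : ∀ a : Fin n, ∑ ρ : Equiv.Perm (Fin n),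
      (if (a : ℕ) < k then (if ρ t = a then (fun m => p * (P ((t : ℕ) + 1) (m + 1) : ℝ))
        (Finset.univ.filter fun u : Fin n => (u : ℕ) < t ∧ ρ u < a).card else 0) else 0) =
      g a := by
    intro a
    simp only [hg]
    by_cases h : (a : ℕ) < k
    · simp only [h, if_true]
      exact sum_card_better a t t le_rfl (fun m => p * (P ((t : ℕ) + 1) (m + 1) : ℝ))
    · simp [h]
  rw [Finset.sum_congr rfl fun a _ => hinner a, Fin.sum_univ_eq_sum_range g n, hg, ← Finset.sum_filter,
    show (Finset.range n).filter (· < k) = Finset.range k by ext; simp; omega, Finset.mul_sum]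
  refine Finset.sum_congr rfl fun a _ => ?_
  rw [Finset.mul_sum, Finset.mul_sum]
  refine Finset.sum_congr rfl fun m _ => ?_
  rw [← Nat.mul_factorial_pred hn.ne']
  have h1 : (n : ℝ) ≠ 0 := by exact_mod_cast hn.ne'
  have h2 : ((n - 1).factorial : ℝ) ≠ 0 := by exact_mod_cast Nat.factorial_ne_zero _
  have h3 : ((n - 1).choose t : ℝ) ≠ 0 := by
    exact_mod_cast (Nat.choose_pos (by omega : (t : ℕ) ≤ n - 1)).ne'
  push_cast
  field_simp

/-! ### From the continuous to the finite problem -/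

/-- The probability that exactly `i` of `n` uniform points lie below `u`. -/
def binomialMass (n i : ℕ) (u : ℝ) : ℝ := (n.choose i : ℝ) * u ^ i * (1 - u) ^ (n - i)

/-- The density of the `(j + 1)`-st of `n` uniform points. -/
def orderStatDensity (n j : ℕ) (u : ℝ) : ℝ :=
  ((j : ℝ) + 1) * (n.choose (j + 1) : ℝ) * u ^ j * (1 - u) ^ (n - (j + 1))

theorem continuous_binomialMass (n i : ℕ) : Continuous (binomialMass n i) := by
  unfold binomialMass; fun_prop

theorem continuous_orderStatDensity (n j : ℕ) : Continuous (orderStatDensity n j) := by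
  unfold orderStatDensity; fun_prop

theorem binomialMass_nonneg (n i : ℕ) {u : ℝ} (hu : u ∈ Set.Icc (0 : ℝ) 1) :
    0 ≤ binomialMass n i u := by
  have h1 := hu.1
  have h2 := sub_nonneg.2 hu.2
  unfold binomialMass; positivity

theorem orderStatDensity_nonneg (n j : ℕ) {u : ℝ} (hu : u ∈ Set.Icc (0 : ℝ) 1) :
    0 ≤ orderStatDensity n j u := by
  have h1 := hu.1
  have h2 := sub_nonneg.2 hu.2
  unfold orderStatDensity; positivity

theorem mul_orderStatDensity (n j : ℕ) (u : ℝ) :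
    u * orderStatDensity n j u = ((j : ℝ) + 1) * binomialMass n (j + 1) u := by
  unfold orderStatDensity binomialMass; ring

theorem hasDerivAt_binomialMass_succ (n i : ℕ) (u : ℝ) :
    HasDerivAt (binomialMass n (i + 1)) (orderStatDensity n i u - orderStatDensity n (i + 1) u)
      u := by
  have h1 : HasDerivAt (fun u : ℝ => u ^ (i + 1)) (((i : ℝ) + 1) * u ^ i) u := by
    simpa using hasDerivAt_pow (i + 1) u
  have h2 : HasDerivAt (fun u : ℝ => (1 - u) ^ (n - (i + 1)))
      (-(((n - (i + 1) : ℕ) : ℝ) * (1 - u) ^ (n - (i + 1) - 1))) u := by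
    have := ((hasDerivAt_id u).const_sub 1).fun_pow (n - (i + 1))
    simpa using this
  have h3 := (h1.const_mul (n.choose (i + 1) : ℝ)).mul h2
  refine h3.congr_deriv ?_
  have hc : (n.choose (i + 1) : ℝ) * ((n - (i + 1) : ℕ) : ℝ) =
      ((i : ℝ) + 1 + 1) * (n.choose (i + 1 + 1) : ℝ) := by
    have := Nat.choose_succ_right_eq n (i + 1)
    have h : (n.choose (i + 1 + 1) : ℝ) * ((i + 1 + 1 : ℕ) : ℝ) =
      n.choose (i + 1) * ((n - (i + 1) : ℕ) : ℝ) := by exact_mod_cast this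
    rw [← h]; push_cast; ring
  unfold orderStatDensity
  rw [← Nat.sub_sub n (i + 1) 1]
  push_cast
  linear_combination (-(u ^ (i + 1) * (1 - u) ^ (n - (i + 1) - 1))) * hc

theorem hasDerivAt_sum_binomialMass (n j : ℕ) (u : ℝ) :
    HasDerivAt (fun u => ∑ i ∈ Finset.range (j + 1), binomialMass n i u)
      (-orderStatDensity n j u) u := by
  induction j with
  | zero =>
    have := ((hasDerivAt_id u).const_sub 1).fun_pow n
    simpa [binomialMass, orderStatDensity] using this
  | succ j ih =>
    simp only [Finset.sum_range_succ _ (j + 1)]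
    exact (ih.add (hasDerivAt_binomialMass_succ n j u)).congr_deriv (by ring)

/-- The `(j + 1)`-st smallest of `n` points exceeds `u` exactly when at most `j` points lie below
`u`. -/
theorem integral_orderStatDensity (n j : ℕ) (hj : j < n) (u : ℝ) :
    ∫ v in u..1, orderStatDensity n j v = ∑ i ∈ Finset.range (j + 1), binomialMass n i u := by
  have h := intervalIntegral.integral_eq_sub_of_hasDerivAt (a := u) (b := 1)
    (fun v _ => (hasDerivAt_sum_binomialMass n j v).neg)
    (by simpa using (continuous_orderStatDensity n j).intervalIntegrable u 1)
  simp only [neg_neg, Pi.neg_apply] at h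
  rw [h, Finset.sum_eq_zero (f := fun i => binomialMass n i 1)]
  · ring
  · intro i hi
    have : n - i ≠ 0 := by have := Finset.mem_range.1 hi; omega
    simp [binomialMass, this]

theorem lintegral_orderStatDensity (n j : ℕ) (hj : j < n) {u : ℝ} (hu : u ∈ Set.Icc (0 : ℝ) 1) :
    ∫⁻ v in Set.Icc u 1, ENNReal.ofReal (orderStatDensity n j v) =
      ENNReal.ofReal (∑ i ∈ Finset.range (j + 1), binomialMass n i u) := by
  rw [← integral_orderStatDensity n j hj, intervalIntegral.integral_of_le hu.2,
    ← integral_Icc_eq_integral_Ioc, ofReal_integral_eq_lintegral_ofReal]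
  · exact (continuous_orderStatDensity n j).continuousOn.integrableOn_compact isCompact_Icc
  · filter_upwards [ae_restrict_mem measurableSet_Icc] with v hv
    exact orderStatDensity_nonneg n j ⟨hu.1.trans hv.1, hv.2⟩

/-- Tonelli on the triangle `τ ≤ v`. -/
theorem lintegral_Icc_swap (A B : ℝ → ENNReal) (hA : Measurable A) (hB : Measurable B) :
    ∫⁻ τ in Set.Icc (0 : ℝ) 1, A τ * ∫⁻ v in Set.Icc τ 1, B v =
      ∫⁻ v in Set.Icc (0 : ℝ) 1, B v * ∫⁻ τ in Set.Icc 0 v, A τ := by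
  set S : Set (ℝ × ℝ) := {x | x.1 ≤ x.2} with hS
  have hSm : MeasurableSet S := measurableSet_le measurable_fst measurable_snd
  set f : ℝ → ℝ → ENNReal := fun τ v => S.indicator (fun x => A x.1 * B x.2) (τ, v) with hf
  have hfm : Measurable (Function.uncurry f) := by
    have : Measurable fun x : ℝ × ℝ => A x.1 * B x.2 :=
      (hA.comp measurable_fst).mul (hB.comp measurable_snd)
    exact this.indicator hSm
  have h1 : ∀ τ ∈ Set.Icc (0 : ℝ) 1, A τ * ∫⁻ v in Set.Icc τ 1, B v =
      ∫⁻ v in Set.Icc (0 : ℝ) 1, f τ v := by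
    intro τ hτ
    have e : ∀ v, f τ v = (Set.Ici τ).indicator (fun v => A τ * B v) v := by
      intro v
      by_cases h : τ ≤ v <;> simp [hf, hS, Set.indicator, h]
    simp only [e]
    rw [lintegral_indicator measurableSet_Ici, Measure.restrict_restrict measurableSet_Ici,
      show Set.Ici τ ∩ Set.Icc 0 1 = Set.Icc τ 1 from ?_, lintegral_const_mul _ hB]
    ext v
    simp only [Set.mem_inter_iff, Set.mem_Ici, Set.mem_Icc]
    exact ⟨fun h => ⟨h.1, h.2.2⟩, fun h => ⟨h.1, hτ.1.trans h.1, h.2⟩⟩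
  have h2 : ∀ v ∈ Set.Icc (0 : ℝ) 1, B v * ∫⁻ τ in Set.Icc 0 v, A τ =
      ∫⁻ τ in Set.Icc (0 : ℝ) 1, f τ v := by
    intro v hv
    have e : ∀ τ, f τ v = (Set.Iic v).indicator (fun τ => B v * A τ) τ := by
      intro τ
      by_cases h : τ ≤ v <;> simp [hf, hS, Set.indicator, h, mul_comm]
    simp only [e]
    rw [lintegral_indicator measurableSet_Iic, Measure.restrict_restrict measurableSet_Iic,
      show Set.Iic v ∩ Set.Icc 0 1 = Set.Icc 0 v from ?_, lintegral_const_mul _ hA]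
    ext τ
    simp only [Set.mem_inter_iff, Set.mem_Iic, Set.mem_Icc]
    exact ⟨fun h => ⟨h.2.1, h.1⟩, fun h => ⟨h.2, h.1, h.2.trans hv.2⟩⟩
  rw [setLIntegral_congr_fun measurableSet_Icc h1, setLIntegral_congr_fun measurableSet_Icc h2]
  exact lintegral_lintegral_swap hfm.aemeasurable

/-! ### Discretization by order statistics -/

namespace CLPFeasible

variable {p : ℝ} {α : ℝ → ℕ → ℝ} {γ : ℝ}

theorem mul_le_one (h : CLPFeasible p α γ) {t : ℝ} (ht : t ∈ Set.Icc (0 : ℝ) 1) (s : ℕ)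
    (hs : 1 ≤ s) : t * α t s ≤ 1 :=
  ENNReal.ofReal_le_one.1 (le_self_add.trans (h.dynamic t ht s hs))

theorem integrableOn_mul (h : CLPFeasible p α γ) (s : ℕ) (hs : 1 ≤ s) :
    IntegrableOn (fun t => t * α t s) (Set.Icc (0 : ℝ) 1) := by
  refine Measure.integrableOn_of_bounded (M := 1) (by simp)
    (measurable_id.mul (h.measurable s hs)).aestronglyMeasurable ?_
  filter_upwards [ae_restrict_mem measurableSet_Icc] with t ht
  rw [Real.norm_eq_abs, abs_of_nonneg (mul_nonneg ht.1 (h.nonneg t ht s hs))]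
  exact h.mul_le_one ht s hs

/-- One factor `t` is spent on controlling `α`, which may be unbounded near `0`; hence the exponent
`j + 1`. -/
theorem integrableOn_mul_pow (h : CLPFeasible p α γ) (s : ℕ) (hs : 1 ≤ s) (j : ℕ) (g : ℝ → ℝ)
    (hg : Continuous g) :
    IntegrableOn (fun t => α t s * (t ^ (j + 1) * g t)) (Set.Icc (0 : ℝ) 1) := by
  have := (h.integrableOn_mul s hs).mul_continuousOn (g' := fun t => t ^ j * g t)
    (by fun_prop) isCompact_Icc
  refine this.congr_fun (fun t _ => ?_) measurableSet_Icc
  ring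

theorem integrableOn_mul_binomialMass (h : CLPFeasible p α γ) (s : ℕ) (hs : 1 ≤ s) (n j : ℕ) :
    IntegrableOn (fun t => α t s * binomialMass n (j + 1) t) (Set.Icc (0 : ℝ) 1) := by
  refine (h.integrableOn_mul_pow s hs j
    (fun t => (n.choose (j + 1) : ℝ) * (1 - t) ^ (n - (j + 1))) (by fun_prop)).congr_fun
    (fun t _ => ?_) measurableSet_Icc
  unfold binomialMass
  ring

end CLPFeasible

/-- The probability that, in the problem with `n` candidates, position `j + 1` is reached and an
offer is made there, relative to partial rank `m + 1`. -/
def discretized (α : ℝ → ℕ → ℝ) (n j m : ℕ) : ℝ :=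
  ∫ t in (0 : ℝ)..1, α t (m + 1) * binomialMass n (j + 1) t

namespace CLPFeasible

variable {p : ℝ} {α : ℝ → ℕ → ℝ} {γ : ℝ}

theorem discretized_nonneg (h : CLPFeasible p α γ) (n j m : ℕ) : 0 ≤ discretized α n j m :=
  intervalIntegral.integral_nonneg zero_le_one fun t ht =>
    mul_nonneg (h.nonneg t ht _ (by omega)) (binomialMass_nonneg _ _ ht)

theorem ofReal_discretized (h : CLPFeasible p α γ) (n j m : ℕ) :
    ENNReal.ofReal (discretized α n j m) =
      ∫⁻ t in Set.Icc (0 : ℝ) 1, ENNReal.ofReal (α t (m + 1)) *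
        ENNReal.ofReal (binomialMass n (j + 1) t) := by
  unfold discretized
  rw [intervalIntegral.integral_of_le zero_le_one, ← integral_Icc_eq_integral_Ioc,
    ofReal_integral_eq_lintegral_ofReal (h.integrableOn_mul_binomialMass _ (by omega) n j)]
  · refine setLIntegral_congr_fun measurableSet_Icc fun t ht => ?_
    exact ENNReal.ofReal_mul (h.nonneg t ht _ (by omega))
  · filter_upwards [ae_restrict_mem measurableSet_Icc] with t ht
    exact mul_nonneg (h.nonneg t ht _ (by omega)) (binomialMass_nonneg _ _ ht)

/-- Integrate the continuous constraint at time `v` against the density of the `(j + 1)`-st order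
statistic. The first term matches by `mul_orderStatDensity`. In the second, exchanging the integrals
turns the density into its tail, a sum of binomial masses. -/
theorem discretized_dynamic (h : CLPFeasible p α γ) (hp : 0 ≤ p) (n j m : ℕ) (hj : j < n) :
    ((j : ℝ) + 1) * discretized α n j m +
      p * ∑ i ∈ Finset.range j, ∑ l ∈ Finset.range (i + 1), discretized α n i l ≤ 1 := by
  have hα : ∀ s, Measurable fun t => ENNReal.ofReal (α t (s + 1)) := fun s =>
    (h.measurable (s + 1) (by omega)).ennreal_ofReal
  have hbin : ∀ i, Measurable fun t => ENNReal.ofReal (binomialMass n i t) := fun i =>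
    (continuous_binomialMass n i).measurable.ennreal_ofReal
  have hαbin : ∀ s i, Measurable fun t =>
      ENNReal.ofReal (α t (s + 1)) * ENNReal.ofReal (binomialMass n i t) := fun s i =>
    (hα s).mul (hbin i)
  set A : ℝ → ENNReal := fun τ => ∑' σ : ℕ, ENNReal.ofReal (α τ (σ + 1)) with hA
  have hAm : Measurable A := Measurable.tsum hα
  have hAbin : ∀ i, Measurable fun t => A t * ENNReal.ofReal (binomialMass n i t) := fun i =>
    hAm.mul (hbin i)
  set B : ℝ → ENNReal := fun v => ENNReal.ofReal (orderStatDensity n j v) with hB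
  have hBm : Measurable B := (continuous_orderStatDensity n j).measurable.ennreal_ofReal
  have hfirst : ENNReal.ofReal (((j : ℝ) + 1) * discretized α n j m) =
      ∫⁻ t in Set.Icc (0 : ℝ) 1, B t * ENNReal.ofReal (t * α t (m + 1)) := by
    rw [ENNReal.ofReal_mul (by positivity), h.ofReal_discretized,
      ← lintegral_const_mul _ (hαbin m (j + 1))]
    refine setLIntegral_congr_fun measurableSet_Icc fun t ht => ?_
    have h0 := h.nonneg t ht (m + 1) (by omega)
    have h1 := binomialMass_nonneg n (j + 1) ht
    simp only [hB]
    rw [← ENNReal.ofReal_mul h0, ← ENNReal.ofReal_mul (by positivity),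
      ← ENNReal.ofReal_mul (orderStatDensity_nonneg n j ht)]
    congr 1
    linear_combination (-(α t (m + 1))) * mul_orderStatDensity n j t
  have hsecond : ENNReal.ofReal (∑ i ∈ Finset.range j, ∑ l ∈ Finset.range (i + 1),
      discretized α n i l) ≤ ∫⁻ v in Set.Icc (0 : ℝ) 1, B v * ∫⁻ τ in Set.Icc 0 v, A τ := by
    rw [← lintegral_Icc_swap A B hAm hBm,
      ENNReal.ofReal_sum_of_nonneg fun i _ => Finset.sum_nonneg fun l _ =>
        h.discretized_nonneg n i l]
    have : ∀ i ∈ Finset.range j, ENNReal.ofReal (∑ l ∈ Finset.range (i + 1),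
        discretized α n i l) ≤
        ∫⁻ t in Set.Icc (0 : ℝ) 1, A t * ENNReal.ofReal (binomialMass n (i + 1) t) := by
      intro i _
      rw [ENNReal.ofReal_sum_of_nonneg fun l _ => h.discretized_nonneg n i l]
      simp only [h.ofReal_discretized]
      rw [← lintegral_finsetSum _ fun l _ => hαbin l (i + 1)]
      refine lintegral_mono fun t => ?_
      simp only
      rw [← Finset.sum_mul]
      gcongr
      -- Partial ranks above `i + 1`, which cannot occur at this position, are dropped.
      exact ENNReal.sum_le_tsum _
    refine (Finset.sum_le_sum this).trans ?_
    rw [← lintegral_finsetSum _ fun i _ => hAbin (i + 1)]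
    refine setLIntegral_mono_ae' measurableSet_Icc (ae_of_all _ fun t ht => ?_)
    rw [← Finset.mul_sum, hB, lintegral_orderStatDensity n j hj ht]
    gcongr
    rw [← ENNReal.ofReal_sum_of_nonneg fun i _ => binomialMass_nonneg n (i + 1) ht]
    apply ENNReal.ofReal_le_ofReal
    -- The mass at `0`, where no point has arrived by time `t`, is given away.
    rw [Finset.sum_range_succ']
    have := binomialMass_nonneg n 0 ht
    linarith
  have htot : ENNReal.ofReal (((j : ℝ) + 1) * discretized α n j m +
      p * ∑ i ∈ Finset.range j, ∑ l ∈ Finset.range (i + 1), discretized α n i l) ≤ 1 := by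
    have h0 : 0 ≤ ∑ i ∈ Finset.range j, ∑ l ∈ Finset.range (i + 1), discretized α n i l :=
      Finset.sum_nonneg fun i _ => Finset.sum_nonneg fun l _ => h.discretized_nonneg n i l
    have h1 := h.discretized_nonneg n j m
    have hIm : Measurable fun v => ∫⁻ τ in Set.Icc 0 v, A τ := by
      apply Monotone.measurable
      intro v w hvw
      exact lintegral_mono_set (Set.Icc_subset_Icc_right hvw)
    have hBI : Measurable fun v => B v * ∫⁻ τ in Set.Icc 0 v, A τ := hBm.mul hIm
    rw [ENNReal.ofReal_add (by positivity) (by positivity), hfirst, ENNReal.ofReal_mul hp]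
    calc _ ≤ (∫⁻ t in Set.Icc (0 : ℝ) 1, B t * ENNReal.ofReal (t * α t (m + 1))) +
          ENNReal.ofReal p * ∫⁻ v in Set.Icc (0 : ℝ) 1, B v * ∫⁻ τ in Set.Icc 0 v, A τ := by
          gcongr
      _ = ∫⁻ v in Set.Icc (0 : ℝ) 1, B v * (ENNReal.ofReal (v * α v (m + 1)) +
            ENNReal.ofReal p * ∫⁻ τ in Set.Icc 0 v, A τ) := by
          rw [← lintegral_const_mul _ hBI, ← lintegral_add_left]
          · refine lintegral_congr fun v => ?_
            ring
          · exact hBm.mul (measurable_id.mul (h.measurable (m + 1) (by omega))).ennreal_ofReal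
      _ ≤ ∫⁻ v in Set.Icc (0 : ℝ) 1, B v := by
          refine setLIntegral_mono_ae' measurableSet_Icc (ae_of_all _ fun v hv => ?_)
          exact mul_le_of_le_one_right' (h.dynamic v hv (m + 1) (by omega))
      _ = 1 := by
          rw [hB, lintegral_orderStatDensity n j hj (by simp), Finset.sum_range_succ']
          simp [binomialMass]
  exact ENNReal.ofReal_le_one.1 htot

end CLPFeasible

/-- Binomial theorem: a candidate with `a` better ones arrives at `τ` after exactly `m` of them, and
the `n - 1 - a` worse candidates fall before or after `τ` freely, with total mass `1`. -/
theorem sum_choose_mul_pow (a m n : ℕ) (ha : a < n) (τ : ℝ) :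
    ∑ t ∈ Finset.range n, (if m ≤ t then (a.choose m : ℝ) * ((n - 1 - a).choose (t - m) : ℝ) *
      (τ ^ (t + 1) * (1 - τ) ^ (n - (t + 1))) else 0) =
      (a.choose m : ℝ) * (τ ^ (m + 1) * (1 - τ) ^ (a - m)) := by
  rcases lt_or_ge a m with h | h
  · simp [Nat.choose_eq_zero_of_lt h]
  have hb : (τ + (1 - τ)) ^ (n - 1 - a) = 1 := by simp
  rw [add_pow] at hb
  have h1 : ∑ t ∈ Finset.range n, (if m ≤ t then (a.choose m : ℝ) *
      ((n - 1 - a).choose (t - m) : ℝ) * (τ ^ (t + 1) * (1 - τ) ^ (n - (t + 1))) else 0) =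
      ∑ i ∈ Finset.range (n - 1 - a + 1), (a.choose m : ℝ) * ((n - 1 - a).choose i : ℝ) *
        (τ ^ (m + i + 1) * (1 - τ) ^ (n - (m + i + 1))) := by
    rw [← Finset.sum_filter, show (Finset.range n).filter (fun t => m ≤ t) = Finset.Ico m n by
      ext; simp; omega, Finset.sum_Ico_eq_sum_range]
    symm
    apply Finset.sum_subset_zero_on_sdiff
    · intro i hi
      have := Finset.mem_range.1 hi
      exact Finset.mem_range.2 (by omega)
    · intro i hi
      rw [Finset.mem_sdiff, Finset.mem_range, Finset.mem_range] at hi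
      rw [add_tsub_cancel_left,
        (Nat.choose_eq_zero_of_lt (by omega) : (n - 1 - a).choose i = 0)]
      simp
    · intro i _
      rw [add_tsub_cancel_left]
  rw [h1]
  calc _ = ∑ i ∈ Finset.range (n - 1 - a + 1), (a.choose m : ℝ) * (τ ^ (m + 1) * (1 - τ) ^ (a - m))
        * (τ ^ i * (1 - τ) ^ (n - 1 - a - i) * ((n - 1 - a).choose i : ℝ)) := by
        refine Finset.sum_congr rfl fun i hi => ?_
        have hi' := Finset.mem_range.1 hi
        rw [show n - (m + i + 1) = (a - m) + (n - 1 - a - i) by omega, pow_add (1 - τ)]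
        ring
    _ = _ := by rw [← Finset.mul_sum, hb, mul_one]

theorem objective_sum_eq (c : ℕ → ℝ) (k : ℕ) (τ : ℝ) :
    ∑ s ∈ Finset.Icc 1 k, c s *
        ∑ l ∈ Finset.Icc s k, ((l - 1).choose (s - 1) : ℝ) * τ ^ s * (1 - τ) ^ (l - s) =
      ∑ a ∈ Finset.range k, ∑ m ∈ Finset.range k,
        c (m + 1) * ((a.choose m : ℝ) * (τ ^ (m + 1) * (1 - τ) ^ (a - m))) := by
  have shift : ∀ f : ℕ → ℝ, ∑ s ∈ Finset.Icc 1 k, f s = ∑ m ∈ Finset.range k, f (m + 1) := by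
    intro f
    rw [Finset.range_eq_Ico, Finset.sum_Ico_add' f 0 k 1]
    rfl
  rw [Finset.sum_comm, shift]
  refine Finset.sum_congr rfl fun m _ => ?_
  rw [← Finset.mul_sum]
  congr 1
  rw [show Finset.Icc (m + 1) k = Finset.Ico (m + 1) (k + 1) from rfl,
    ← Finset.sum_Ico_add' (fun l => ((l - 1).choose (m + 1 - 1) : ℝ) *
      τ ^ (m + 1) * (1 - τ) ^ (l - (m + 1))) m k 1]
  rw [Finset.sum_subset (s₁ := Finset.Ico m k) (s₂ := Finset.range k)]
  · refine Finset.sum_congr rfl fun a _ => ?_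
    simp only [Nat.add_sub_cancel, Nat.add_sub_add_right]
    ring
  · intro a; simp
  · intro a ha ha2
    rw [Finset.mem_Ico] at ha2
    rw [Finset.mem_range] at ha
    simp [(Nat.choose_eq_zero_of_lt (by omega) : a.choose m = 0)]

theorem objective_kernel_eq (c : ℕ → ℝ) (n k : ℕ) (hk : k ≤ n) (τ : ℝ) :
    ∑ s ∈ Finset.Icc 1 k, c s *
        ∑ l ∈ Finset.Icc s k, ((l - 1).choose (s - 1) : ℝ) * τ ^ s * (1 - τ) ^ (l - s) =
      ∑ t ∈ Finset.range n, ∑ a ∈ Finset.range k, ∑ m ∈ Finset.range (t + 1),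
        c (m + 1) * (τ ^ (t + 1) * (1 - τ) ^ (n - (t + 1))) *
          ((a.choose m : ℝ) * ((n - 1 - a).choose (t - m) : ℝ)) := by
  have hR : ∀ t ∈ Finset.range n, ∀ a ∈ Finset.range k, ∑ m ∈ Finset.range (t + 1),
        c (m + 1) * (τ ^ (t + 1) * (1 - τ) ^ (n - (t + 1))) *
          ((a.choose m : ℝ) * ((n - 1 - a).choose (t - m) : ℝ)) =
      ∑ m ∈ Finset.range n, c (m + 1) * (if m ≤ t then (a.choose m : ℝ) *
        ((n - 1 - a).choose (t - m) : ℝ) * (τ ^ (t + 1) * (1 - τ) ^ (n - (t + 1))) else 0) := by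
    intro t ht a _
    have ht' := Finset.mem_range.1 ht
    simp only [mul_ite, mul_zero]
    rw [← Finset.sum_filter, show (Finset.range n).filter (fun m => m ≤ t) = Finset.range (t + 1) by
      ext; simp; omega]
    exact Finset.sum_congr rfl fun m _ => by ring
  rw [Finset.sum_congr rfl fun t ht => Finset.sum_congr rfl fun a ha => hR t ht a ha,
    Finset.sum_comm]
  have hR2 : ∀ a ∈ Finset.range k, ∑ t ∈ Finset.range n, ∑ m ∈ Finset.range n,
      c (m + 1) * (if m ≤ t then (a.choose m : ℝ) *
        ((n - 1 - a).choose (t - m) : ℝ) * (τ ^ (t + 1) * (1 - τ) ^ (n - (t + 1))) else 0) =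
      ∑ m ∈ Finset.range k, c (m + 1) * ((a.choose m : ℝ) * (τ ^ (m + 1) * (1 - τ) ^ (a - m))) := by
    intro a ha
    have ha' := Finset.mem_range.1 ha
    rw [Finset.sum_comm]
    simp only [← Finset.mul_sum]
    rw [Finset.sum_congr rfl fun m _ => by rw [sum_choose_mul_pow a m n (by omega) τ]]
    symm
    apply Finset.sum_subset (by simpa using hk)
    intro m _ hm
    rw [Finset.mem_range] at hm
    rw [(Nat.choose_eq_zero_of_lt (by omega) : a.choose m = 0)]
    simp
  rw [objective_sum_eq]
  exact (Finset.sum_congr rfl hR2).symm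

/-- The policy making an offer in each state with the conditional probability prescribed by a
discretized solution of the continuous linear program. -/
theorem exists_policy {p : ℝ} (hp : 0 < p) (n : ℕ) (y : ℕ → ℕ → ℝ) (hy : ∀ j m, 0 ≤ y j m)
    (hdyn : ∀ j m, j < n → ((j : ℝ) + 1) * y j m +
      p * ∑ i ∈ Finset.range j, ∑ l ∈ Finset.range (i + 1), y i l ≤ 1) :
    ∃ P : Policy, ∀ j < n, ∀ m,
      reachProb p P j * P (j + 1) (m + 1) = ((j : ℝ) + 1) * y j m := by
  set D : ℕ → ℝ := fun j => 1 - p * ∑ i ∈ Finset.range j, ∑ l ∈ Finset.range (i + 1), y i l with hD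
  have hle : ∀ j m, j < n → ((j : ℝ) + 1) * y j m ≤ D j := by
    intro j m hj
    have := hdyn j m hj
    simp only [hD]; linarith
  -- Offer mass divided by reach probability. In the relevant range the projection to `[0, 1]`
  -- changes nothing: `hle` bounds the quotient when the denominator is positive, and forces `y` to
  -- vanish when it is zero.
  set P : Policy := fun j m =>
    Set.projIcc (0 : ℝ) 1 zero_le_one ((j : ℝ) * y (j - 1) (m - 1) / D (j - 1)) with hP
  have hDP : ∀ j < n, ∀ m, D j * (P (j + 1) (m + 1) : ℝ) = ((j : ℝ) + 1) * y j m := by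
    intro j hj m
    have h1 := hle j m hj
    have h0 : 0 ≤ ((j : ℝ) + 1) * y j m := mul_nonneg (by positivity) (hy j m)
    rcases (h0.trans h1).eq_or_lt with h | h
    · rw [← h, zero_mul]; linarith
    · simp only [hP, Nat.add_sub_cancel]
      push_cast
      rw [min_eq_right ((div_le_one h).2 h1),
        max_eq_right (div_nonneg h0 h.le), mul_div_cancel₀ _ h.ne']
  have hreach : ∀ j ≤ n, reachProb p P j = D j := by
    intro j
    induction j with
    | zero => intro _; simp [reachProb, hD]
    | succ j ih =>
      intro hj
      have e := ih (by omega)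
      unfold reachProb at e ⊢
      rw [Finset.prod_range_succ, e]
      have : D (j + 1) = D j - p * ∑ l ∈ Finset.range (j + 1), y j l := by
        simp only [hD, Finset.sum_range_succ _ j]; ring
      rw [this]
      have h2 : D j * ∑ s ∈ Finset.range (j + 1), (P (j + 1) (s + 1) : ℝ) =
          ((j : ℝ) + 1) * ∑ l ∈ Finset.range (j + 1), y j l := by
        rw [Finset.mul_sum, Finset.mul_sum]
        exact Finset.sum_congr rfl fun s _ => hDP j (by omega) s
      have h3 : (0 : ℝ) < (j : ℝ) + 1 := by positivity
      rw [mul_sub, mul_one]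
      congr 1
      field_simp
      linear_combination h2
  exact ⟨P, fun j hj m => by rw [hreach j hj.le, hDP j hj m]⟩

/-- A feasible solution of the continuous linear program yields a policy for `n` candidates that
is at least as good. -/
theorem CLPFeasible.exists_le_robustRatio {p : ℝ} {α : ℝ → ℕ → ℝ} {γ : ℝ} (h : CLPFeasible p α γ)
    (hp : 0 < p) (n : ℕ) (hn : 1 ≤ n) : ∃ P : Policy, γ ≤ robustRatio n p P := by
  obtain ⟨P, hP⟩ := exists_policy hp n (discretized α n) (h.discretized_nonneg n)
    (fun j m hj => h.discretized_dynamic hp.le n j m hj)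
  refine ⟨P, ?_⟩
  have : Nonempty (Fin n) := ⟨⟨0, hn⟩⟩
  refine le_ciInf fun k => ?_
  have hk : (k : ℕ) + 1 ≤ n := k.2
  rw [prob_someTopAccepts p P _ hk, prob_collectsTop p P _ hk]
  refine (h.objective ((k : ℕ) + 1) (by omega)).trans (le_of_eq ?_)
  congr 1
  simp only [objective_kernel_eq _ n _ hk]
  have hint : ∀ t m a : ℕ, IntervalIntegrable (fun τ => α τ (m + 1) *
      (τ ^ (t + 1) * (1 - τ) ^ (n - (t + 1))) *
          ((a.choose m : ℝ) * ((n - 1 - a).choose (t - m) : ℝ))) volume 0 1 := by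
    intro t m a
    rw [intervalIntegrable_iff_integrableOn_Icc_of_le zero_le_one]
    exact (h.integrableOn_mul_pow (m + 1) (by omega) t (fun τ => (1 - τ) ^ (n - (t + 1)))
      (by fun_prop)).mul_const _
  have hint2 : ∀ t a : ℕ, IntervalIntegrable (fun τ => ∑ m ∈ Finset.range (t + 1), α τ (m + 1) *
      (τ ^ (t + 1) * (1 - τ) ^ (n - (t + 1))) *
          ((a.choose m : ℝ) * ((n - 1 - a).choose (t - m) : ℝ))) volume 0 1 := by
    intro t a
    have := IntervalIntegrable.sum (Finset.range (t + 1)) fun m _ => hint t m a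
    rwa [Finset.sum_fn] at this
  have hint3 : ∀ t : ℕ, IntervalIntegrable (fun τ => ∑ a ∈ Finset.range ((k : ℕ) + 1),
      ∑ m ∈ Finset.range (t + 1), α τ (m + 1) *
      (τ ^ (t + 1) * (1 - τ) ^ (n - (t + 1))) *
          ((a.choose m : ℝ) * ((n - 1 - a).choose (t - m) : ℝ))) volume 0 1 := by
    intro t
    have := IntervalIntegrable.sum (Finset.range ((k : ℕ) + 1)) fun a _ => hint2 t a
    rwa [Finset.sum_fn] at this
  rw [intervalIntegral.integral_finsetSum fun t _ => hint3 t, Finset.mul_sum]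
  refine Finset.sum_congr rfl fun t ht => ?_
  have ht' := Finset.mem_range.1 ht
  rw [intervalIntegral.integral_finsetSum fun a _ => hint2 t a, Finset.mul_sum, Finset.mul_sum]
  refine Finset.sum_congr rfl fun a _ => ?_
  rw [intervalIntegral.integral_finsetSum fun m _ => hint t m a, Finset.mul_sum, Finset.mul_sum]
  refine Finset.sum_congr rfl fun m _ => ?_
  have hy := hP t ht' m
  have hdisc : discretized α n t m = (n.choose (t + 1) : ℝ) *
      ∫ τ in (0 : ℝ)..1, α τ (m + 1) * (τ ^ (t + 1) * (1 - τ) ^ (n - (t + 1))) := by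
    unfold discretized binomialMass
    rw [← intervalIntegral.integral_const_mul]
    congr 1; ext τ; ring
  rw [intervalIntegral.integral_mul_const]
  have hch : ((t : ℝ) + 1) * (n.choose (t + 1) : ℝ) = n * ((n - 1).choose t : ℝ) := by
    have := Nat.add_one_mul_choose_eq (n - 1) t
    rw [Nat.sub_add_cancel hn] at this
    have h2 : (n : ℝ) * ((n - 1).choose t : ℝ) = n.choose (t + 1) * ((t + 1 : ℕ) : ℝ) := by
      exact_mod_cast this
    rw [h2]; push_cast; ring
  have hc0 : (0 : ℝ) < n * ((n - 1).choose t : ℝ) := by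
    have h1 : 0 < (n - 1).choose t := Nat.choose_pos (by omega)
    have h2 : (0 : ℝ) < n := by exact_mod_cast hn
    have h3 : (0 : ℝ) < ((n - 1).choose t : ℝ) := by exact_mod_cast h1
    positivity
  rw [hdisc, ← mul_assoc, hch] at hy
  rw [show reachProb p P t * (p * (P (t + 1) (m + 1) : ℝ) * ((a.choose m : ℝ) *
    ((n - 1 - a).choose (t - m) : ℝ) / (n * ((n - 1).choose t : ℝ)))) =
    (reachProb p P t * P (t + 1) (m + 1)) * p * ((a.choose m : ℝ) *
    ((n - 1 - a).choose (t - m) : ℝ)) / (n * ((n - 1).choose t : ℝ)) by ring, hy, eq_div_iff hc0.ne']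
  ring

/-! ### The cutoff -/

theorem cutoff_pos {p : ℝ} (hp : 0 < p) : 0 < cutoff p := by
  unfold cutoff; split_ifs
  · exact Real.exp_pos _
  · exact Real.rpow_pos_of_pos hp _

theorem cutoff_lt_one {p : ℝ} (hp : 0 < p) (hp1 : p ≤ 1) : cutoff p < 1 := by
  unfold cutoff; split_ifs with h
  · rw [← Real.exp_zero]; exact Real.exp_lt_exp.2 (by norm_num)
  · have : p < 1 := lt_of_le_of_ne hp1 h
    exact Real.rpow_lt_one hp.le this (by apply one_div_pos.2; linarith)

theorem cutoff_rpow {p : ℝ} (hp : 0 < p) : cutoff p ^ p = ratioValue p := by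
  unfold cutoff ratioValue; split_ifs with h
  · rw [h, Real.rpow_one]
  · rw [← Real.rpow_mul hp.le]; congr 1; ring

theorem mul_ratioValue {p : ℝ} (hp : 0 < p) : p * ratioValue p = cutoff p := by
  unfold cutoff ratioValue; split_ifs with h
  · rw [h, one_mul]
  · have h1 : 1 - p ≠ 0 := sub_ne_zero.2 (Ne.symm h)
    nth_rewrite 1 [← Real.rpow_one p]
    rw [← Real.rpow_add hp]; congr 1; field_simp; ring

theorem ratioValue_pos {p : ℝ} (hp : 0 < p) : 0 < ratioValue p := by
  rw [← cutoff_rpow hp]; exact Real.rpow_pos_of_pos (cutoff_pos hp) _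

/-- `∫ u in t..1, u ^ (-p)`. -/
def powerTail (p t : ℝ) : ℝ := ∫ u in t..1, u ^ (-p)

/-- This normalization singles out the cutoff. It gives the unit mass in Jensen's inequality and the
total mass of the dual weight. -/
theorem powerTail_cutoff {p : ℝ} (hp : 0 < p) (hp1 : p ≤ 1) : powerTail p (cutoff p) = 1 := by
  have hc := cutoff_pos hp
  have h0 : (0 : ℝ) ∉ Set.uIcc (cutoff p) 1 := by
    rw [Set.uIcc_of_le (cutoff_lt_one hp hp1).le]; exact fun h => absurd h.1 (not_le.2 hc)
  unfold powerTail
  rcases hp1.eq_or_lt with h | h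
  · subst h
    simp only [Real.rpow_neg_one]
    rw [integral_inv h0]
    simp [cutoff]
  · rw [integral_rpow (Or.inr ⟨by linarith, h0⟩), Real.one_rpow]
    have : cutoff p ^ (-p + 1) = p := by
      unfold cutoff
      rw [if_neg h.ne, ← Real.rpow_mul hp.le]
      have : 1 - p ≠ 0 := by linarith
      rw [show 1 / (1 - p) * (-p + 1) = 1 by field_simp; ring, Real.rpow_one]
    rw [this, div_eq_one_iff_eq (by linarith)]; ring

theorem hasDerivAt_powerTail (p : ℝ) {t : ℝ} (ht : 0 < t) :
    HasDerivAt (powerTail p) (-t ^ (-p)) t := by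
  have hcont : ContinuousOn (fun u : ℝ => u ^ (-p)) (Set.Ioi 0) := fun u hu =>
    (Real.continuousAt_rpow_const u (-p) (Or.inl (ne_of_gt hu))).continuousWithinAt
  have hsub : Set.uIcc t 1 ⊆ Set.Ioi (0 : ℝ) := fun u hu =>
    lt_of_lt_of_le (lt_min ht one_pos) hu.1
  exact intervalIntegral.integral_hasDerivAt_left ((hcont.mono hsub).intervalIntegrable)
    (hcont.stronglyMeasurableAtFilter isOpen_Ioi t ht) (hcont.continuousAt (Ioi_mem_nhds ht))

theorem powerTail_one (p : ℝ) : powerTail p 1 = 0 := by simp [powerTail]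

theorem powerTail_anti (p : ℝ) {s t : ℝ} (hs : 0 < s) (hst : s ≤ t) :
    powerTail p t ≤ powerTail p s := by
  have : AntitoneOn (powerTail p) (Set.Ioi 0) := by
    apply antitoneOn_of_deriv_nonpos (convex_Ioi 0)
    · exact fun t ht => (hasDerivAt_powerTail p ht).continuousAt.continuousWithinAt
    · intro t ht
      rw [interior_Ioi] at ht
      exact (hasDerivAt_powerTail p ht).differentiableAt.differentiableWithinAt
    · intro t ht
      rw [interior_Ioi] at ht
      rw [(hasDerivAt_powerTail p ht).deriv]
      have := Real.rpow_pos_of_pos ht (-p)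
      linarith
  exact this hs (hs.trans_le hst) hst

/-! ### The dual bound for the best candidate -/

/-- The dual weight, from the cutoff on. -/
def dualDensity (p t : ℝ) : ℝ := 1 - p * t ^ (p - 1) * powerTail p t

/-- The integral of the dual weight over `[t, 1]`. -/
def dualTail (p t : ℝ) : ℝ := t ^ p * powerTail p t

theorem hasDerivAt_dualTail (p : ℝ) {t : ℝ} (ht : 0 < t) :
    HasDerivAt (dualTail p) (-dualDensity p t) t := by
  have h := (Real.hasDerivAt_rpow_const (p := p) (Or.inl ht.ne')).mul (hasDerivAt_powerTail p ht)
  refine h.congr_deriv ?_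
  have : t ^ p * t ^ (-p) = 1 := by rw [← Real.rpow_add ht]; simp
  unfold dualDensity
  linear_combination -this

theorem dualDensity_mono {p : ℝ} (hp : 0 < p) (hp1 : p ≤ 1) {s t : ℝ} (hs : 0 < s) (hst : s ≤ t)
    (ht : t ≤ 1) : dualDensity p s ≤ dualDensity p t := by
  have h1 : t ^ (p - 1) ≤ s ^ (p - 1) := Real.rpow_le_rpow_of_nonpos hs hst (by linarith)
  have h2 := powerTail_anti p hs hst
  have h3 : 0 ≤ powerTail p t := by
    rw [← powerTail_one p]; exact powerTail_anti p (hs.trans_le hst) ht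
  have h4 : 0 < s ^ (p - 1) := Real.rpow_pos_of_pos hs _
  unfold dualDensity
  have : p * t ^ (p - 1) * powerTail p t ≤ p * s ^ (p - 1) * powerTail p s := by gcongr
  linarith

/-- The weight reaches zero exactly at the cutoff, so extending it by zero to the left keeps it
monotone. -/
theorem dualDensity_cutoff {p : ℝ} (hp : 0 < p) (hp1 : p ≤ 1) : dualDensity p (cutoff p) = 0 := by
  have hc := cutoff_pos hp
  unfold dualDensity
  rw [powerTail_cutoff hp hp1, Real.rpow_sub hc, cutoff_rpow hp, Real.rpow_one, mul_one,
    ← mul_div_assoc, mul_ratioValue hp, div_self hc.ne', sub_self]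

theorem dualDensity_one (p : ℝ) : dualDensity p 1 = 1 := by simp [dualDensity, powerTail_one]

/-- The dual constraint is tight from the cutoff on. -/
theorem mul_dualDensity (p : ℝ) {t : ℝ} (ht : 0 < t) :
    t * dualDensity p t + p * dualTail p t = t := by
  unfold dualDensity dualTail
  rw [Real.rpow_sub ht, Real.rpow_one]
  field_simp
  ring

/-- Mean value theorem together with monotonicity of the density. -/
theorem dualTail_sub_bounds {p : ℝ} (hp : 0 < p) (hp1 : p ≤ 1) {a b : ℝ} (ha : 0 < a) (hab : a ≤ b)
    (hb : b ≤ 1) : (b - a) * dualDensity p a ≤ dualTail p a - dualTail p b ∧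
      dualTail p a - dualTail p b ≤ (b - a) * dualDensity p b := by
  rcases hab.eq_or_lt with rfl | h
  · simp
  obtain ⟨c, hc, e⟩ := exists_hasDerivAt_eq_slope (dualTail p) (fun t => -dualDensity p t) h
    (fun t ht => (hasDerivAt_dualTail p (ha.trans_le ht.1)).continuousAt.continuousWithinAt)
    (fun t ht => hasDerivAt_dualTail p (ha.trans ht.1))
  rw [eq_div_iff (by linarith)] at e
  have h1 := dualDensity_mono hp hp1 ha hc.1.le (hc.2.le.trans hb)
  have h2 := dualDensity_mono hp hp1 (ha.trans hc.1) hc.2.le hb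
  have hba : 0 < b - a := by linarith
  constructor <;> nlinarith

/-- The dual weight. -/
def dualWeight (p t : ℝ) : ℝ := if t < cutoff p then 0 else dualDensity p t

theorem dualWeight_nonneg {p : ℝ} (hp : 0 < p) (hp1 : p ≤ 1) {t : ℝ} (ht : t ≤ 1) :
    0 ≤ dualWeight p t := by
  unfold dualWeight; split_ifs with h
  · exact le_rfl
  · rw [← dualDensity_cutoff hp hp1]
    exact dualDensity_mono hp hp1 (cutoff_pos hp) (not_lt.1 h) ht

theorem dualTail_max_bounds {p : ℝ} (hp : 0 < p) (hp1 : p ≤ 1) {a b : ℝ} (hab : a ≤ b)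
    (hb : b ≤ 1) :
    (b - a) * dualWeight p a ≤ dualTail p (max a (cutoff p)) - dualTail p (max b (cutoff p)) ∧
      dualTail p (max a (cutoff p)) - dualTail p (max b (cutoff p)) ≤ (b - a) * dualWeight p b := by
  have hc := cutoff_pos hp
  unfold dualWeight
  rcases lt_or_ge b (cutoff p) with h1 | h1
  · rw [if_pos h1, if_pos (hab.trans_lt h1), max_eq_right h1.le, max_eq_right (hab.trans h1.le)]
    simp
  · rw [max_eq_left h1, if_neg (not_lt.2 h1)]
    rcases lt_or_ge a (cutoff p) with h2 | h2
    · rw [if_pos h2, max_eq_right h2.le]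
      have h3 := dualTail_sub_bounds hp hp1 hc h1 hb
      rw [dualDensity_cutoff hp hp1] at h3
      have h4 := dualDensity_mono hp hp1 hc h1 hb
      rw [dualDensity_cutoff hp hp1] at h4
      have h5 : (b - cutoff p) * dualDensity p b ≤ (b - a) * dualDensity p b := by gcongr
      constructor <;> linarith [h3.1, h3.2]
    · rw [if_neg (not_lt.2 h2), max_eq_left h2]
      exact dualTail_sub_bounds hp hp1 (hc.trans_le h2) hab hb

/-- Weak duality for the problem of collecting the best of `n` candidates. -/
theorem sum_le_of_dynamic {p : ℝ} (hp : 0 < p) (hp1 : p ≤ 1) (n : ℕ) (hn : 1 ≤ n) (y : ℕ → ℝ)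
    (hy : ∀ t, 0 ≤ y t)
    (hdyn : ∀ t < n, ((t : ℝ) + 1) * y t + p * ∑ u ∈ Finset.range t, y u ≤ 1) :
    ∑ t ∈ Finset.range n, y t * (((t : ℝ) + 1) / n) ≤ ratioValue p + 1 / n := by
  have hn0 : (0 : ℝ) < n := by exact_mod_cast hn
  set w : ℕ → ℝ := fun t => 1 / n * dualWeight p (((t : ℝ) + 1) / n) with hw
  set W : ℕ → ℝ := fun t => dualTail p (max ((t : ℝ) / n) (cutoff p)) with hW
  have hx1 : ∀ t < n, ((t : ℝ) + 1) / n ≤ 1 := by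
    intro t ht
    rw [div_le_one hn0]
    exact_mod_cast ht
  have hgap : ∀ t : ℕ, ((t : ℝ) + 1) / n - (t : ℝ) / n = 1 / n := fun t => by ring
  have hmono : ∀ t : ℕ, (t : ℝ) / n ≤ ((t : ℝ) + 1) / n := fun t => by gcongr; linarith
  have hup : ∀ t < n, W t - W (t + 1) ≤ w t := by
    intro t ht
    have := (dualTail_max_bounds hp hp1 (hmono t) (hx1 t ht)).2
    rw [hgap] at this
    simpa [hw, hW] using this
  -- Each sample is bounded by the cell to its right. The last sample, at time `1`, has no such
  -- cell; it equals `1 / n` and is the whole error term.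
  have hlow : ∀ t, t + 1 < n → w t ≤ W (t + 1) - W (t + 2) := by
    intro t ht
    have h2 := hx1 (t + 1) ht
    have h3 := hmono (t + 1)
    have h4 := hgap (t + 1)
    have := (dualTail_max_bounds hp hp1 h3 h2).1
    rw [h4] at this
    simp only [hw, hW]
    push_cast at this ⊢
    rw [show (t : ℝ) + 2 = t + 1 + 1 by ring]
    exact this
  have hwn : ∀ t < n, 0 ≤ w t := fun t ht =>
    mul_nonneg (by positivity) (dualWeight_nonneg hp hp1 (hx1 t ht))
  have hc1 := (cutoff_lt_one hp hp1).le
  have hWn : W n = 0 := by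
    simp only [hW, div_self hn0.ne', max_eq_left hc1, dualTail, powerTail_one, mul_zero]
  have hW0 : W 0 = ratioValue p := by
    simp only [hW, Nat.cast_zero, zero_div, max_eq_right (cutoff_pos hp).le, dualTail,
      powerTail_cutoff hp hp1, mul_one, cutoff_rpow hp]
  have hW_anti : W 1 ≤ W 0 := by
    have := (dualTail_max_bounds hp hp1 (hmono 0) (hx1 0 hn)).1
    have h0 := dualWeight_nonneg hp hp1 (t := ((0 : ℕ) : ℝ) / n) (by simp)
    have h1 : 0 ≤ (((0 : ℕ) : ℝ) + 1) / n - ((0 : ℕ) : ℝ) / n := by linarith [hmono 0]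
    have h2 := mul_nonneg h1 h0
    simp only [hW]
    push_cast at *
    rw [zero_add] at this h2
    linarith
  have hwsum : ∑ t ∈ Finset.range n, w t ≤ ratioValue p + 1 / n := by
    obtain ⟨N, rfl⟩ : ∃ N, n = N + 1 := ⟨n - 1, by omega⟩
    rw [Finset.sum_range_succ]
    have h1 : ∑ t ∈ Finset.range N, w t ≤ ∑ t ∈ Finset.range N, (W (t + 1) - W (t + 2)) :=
      Finset.sum_le_sum fun t ht => hlow t (by have := Finset.mem_range.1 ht; omega)
    rw [Finset.sum_range_sub' (fun t => W (t + 1)) N, hWn] at h1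
    have h2 : w N = 1 / ((N + 1 : ℕ) : ℝ) := by
      simp only [hw]
      push_cast at hn0 ⊢
      rw [div_self hn0.ne', dualWeight, if_neg (not_lt.2 hc1), dualDensity_one, mul_one]
    rw [h2]
    simp only [zero_add] at h1
    linarith
  -- Dual feasibility. From the cutoff on it comes from `mul_dualDensity`; before it the weight is
  -- zero, but the tail contributes `p * ratioValue p = cutoff p`, which exceeds the coefficient.
  have hcoef : ∀ t < n, ((t : ℝ) + 1) / n ≤
      ((t : ℝ) + 1) * w t + p * ∑ u ∈ Finset.Ico (t + 1) n, w u := by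
    intro t ht
    have h1 : W (t + 1) ≤ ∑ u ∈ Finset.Ico (t + 1) n, w u := by
      have e : ∑ u ∈ Finset.Ico (t + 1) n, (W u - W (u + 1)) = W (t + 1) := by
        rw [Finset.sum_Ico_eq_sum_range]
        have := Finset.sum_range_sub' (fun i => W (t + 1 + i)) (n - (t + 1))
        rw [show t + 1 + (n - (t + 1)) = n by omega, hWn, add_zero, sub_zero] at this
        exact this
      rw [← e]
      exact Finset.sum_le_sum fun u hu => hup u (Finset.mem_Ico.1 hu).2
    have h2 : ((t : ℝ) + 1) / n ≤ ((t : ℝ) + 1) * w t + p * W (t + 1) := by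
      set x : ℝ := ((t : ℝ) + 1) / n with hx
      have hx0 : 0 < x := by positivity
      have e1 : ((t : ℝ) + 1) * w t = x * dualWeight p x := by simp only [hw, hx]; ring
      have e2 : W (t + 1) = dualTail p (max x (cutoff p)) := by simp only [hW, hx]; push_cast; rfl
      rw [e1, e2, dualWeight]
      split_ifs with h
      · rw [max_eq_right h.le, mul_zero, zero_add, dualTail, powerTail_cutoff hp hp1, mul_one,
          cutoff_rpow hp, mul_ratioValue hp]
        exact h.le
      · rw [max_eq_left (not_lt.1 h), mul_dualDensity p hx0]
    have h3 := mul_le_mul_of_nonneg_left h1 hp.le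
    linarith
  calc ∑ t ∈ Finset.range n, y t * (((t : ℝ) + 1) / n)
      ≤ ∑ t ∈ Finset.range n, y t *
          (((t : ℝ) + 1) * w t + p * ∑ u ∈ Finset.Ico (t + 1) n, w u) :=
        Finset.sum_le_sum fun t ht =>
          mul_le_mul_of_nonneg_left (hcoef t (Finset.mem_range.1 ht)) (hy t)
    _ = ∑ t ∈ Finset.range n, w t * (((t : ℝ) + 1) * y t + p * ∑ u ∈ Finset.range t, y u) := by
        have h := Finset.sum_Ico_Ico_comm' 0 n (fun i j => p * (y i * w j))
        simp only [← Finset.range_eq_Ico] at h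
        have e1 : ∀ t, y t * (((t : ℝ) + 1) * w t + p * ∑ u ∈ Finset.Ico (t + 1) n, w u) =
            y t * (((t : ℝ) + 1) * w t) + ∑ u ∈ Finset.Ico (t + 1) n, p * (y t * w u) := by
          intro t
          rw [mul_add, Finset.mul_sum, Finset.mul_sum]
          congr 1
          exact Finset.sum_congr rfl fun u _ => by ring
        have e2 : ∀ t, w t * (((t : ℝ) + 1) * y t + p * ∑ u ∈ Finset.range t, y u) =
            y t * (((t : ℝ) + 1) * w t) + ∑ u ∈ Finset.range t, p * (y u * w t) := by
          intro t; rw [← Finset.mul_sum, ← Finset.sum_mul]; ring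
        simp only [e1, e2, Finset.sum_add_distrib]
        rw [h]
    _ ≤ ∑ t ∈ Finset.range n, w t * 1 :=
        Finset.sum_le_sum fun t ht => mul_le_mul_of_nonneg_left
          (hdyn t (Finset.mem_range.1 ht)) (hwn t (Finset.mem_range.1 ht))
    _ ≤ _ := by simpa using hwsum

/-! ### Upper bound on the robust ratio of every policy -/

theorem reachProb_succ (p : ℝ) (P : Policy) (t : ℕ) :
    reachProb p P (t + 1) = reachProb p P t *
      (1 - p / ((t : ℝ) + 1) * ∑ s ∈ Finset.range (t + 1), (P (t + 1) (s + 1) : ℝ)) :=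
  Finset.prod_range_succ _ _

theorem reachProb_nonneg {p : ℝ} (hp : 0 ≤ p) (hp1 : p ≤ 1) (P : Policy) (t : ℕ) :
    0 ≤ reachProb p P t := by
  refine Finset.prod_nonneg fun u _ => ?_
  have h1 : ∑ s ∈ Finset.range (u + 1), (P (u + 1) (s + 1) : ℝ) ≤ (u : ℝ) + 1 := by
    refine (Finset.sum_le_sum fun s _ => (P (u + 1) (s + 1)).2.2).trans ?_
    simp
  have h2 : (0 : ℝ) < (u : ℝ) + 1 := by positivity
  have h3 : p / ((u : ℝ) + 1) * ∑ s ∈ Finset.range (u + 1), (P (u + 1) (s + 1) : ℝ) ≤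
      p / ((u : ℝ) + 1) * ((u : ℝ) + 1) := by gcongr
  rw [div_mul_cancel₀ _ h2.ne'] at h3
  linarith

theorem robustRatio_le {p : ℝ} (hp : 0 < p) (hp1 : p ≤ 1) (n : ℕ) (hn : 1 ≤ n) (P : Policy) :
    robustRatio n p P ≤ ratioValue p + 1 / n := by
  -- Only offers to partial rank `1` are recorded. The others cannot collect the best candidate and
  -- merely lower the reach probabilities.
  set y : ℕ → ℝ := fun t => reachProb p P t * P (t + 1) 1 / ((t : ℝ) + 1) with hy
  have hP : ∀ t s, 0 ≤ (P t s : ℝ) := fun t s => (P t s).2.1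
  have hr := reachProb_nonneg hp.le hp1 P
  have hy0 : ∀ t, 0 ≤ y t := fun t => div_nonneg (mul_nonneg (hr t) (hP _ _)) (by positivity)
  have hyt : ∀ t : ℕ, ((t : ℝ) + 1) * y t ≤ reachProb p P t := by
    intro t
    have h2 : (t : ℝ) + 1 ≠ 0 := by positivity
    simp only [hy]
    rw [mul_div_cancel₀ _ h2]
    exact mul_le_of_le_one_right (hr t) (P _ _).2.2
  have hreach : ∀ t, reachProb p P t ≤ 1 - p * ∑ u ∈ Finset.range t, y u := by
    intro t
    induction t with
    | zero => simp [reachProb]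
    | succ t ih =>
      rw [reachProb_succ, Finset.sum_range_succ y]
      have h1 : (P (t + 1) 1 : ℝ) ≤ ∑ s ∈ Finset.range (t + 1), (P (t + 1) (s + 1) : ℝ) :=
        Finset.single_le_sum (f := fun s => (P (t + 1) (s + 1) : ℝ)) (fun s _ => hP _ _)
          (Finset.mem_range.2 (Nat.succ_pos t))
      have h2 : p * y t ≤ reachProb p P t * (p / ((t : ℝ) + 1) *
          ∑ s ∈ Finset.range (t + 1), (P (t + 1) (s + 1) : ℝ)) := by
        have h3 : reachProb p P t * (p / ((t : ℝ) + 1) * P (t + 1) 1) ≤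
          reachProb p P t * (p / ((t : ℝ) + 1) *
          ∑ s ∈ Finset.range (t + 1), (P (t + 1) (s + 1) : ℝ)) := by
          gcongr
          exact hr t
        refine le_trans (le_of_eq ?_) h3
        simp only [hy]; ring
      linarith
  have hmain := sum_le_of_dynamic hp hp1 n hn y hy0 fun t _ => by
    linarith [hyt t, hreach t]
  refine le_trans (ciInf_le (Set.finite_range _).bddBelow (⟨0, hn⟩ : Fin n)) (le_trans ?_ hmain)
  simp only
  rw [prob_someTopAccepts p P _ (by omega), prob_collectsTop p P _ (by omega), zero_add, pow_one,
    sub_sub_cancel, div_le_iff₀ hp, Finset.sum_mul]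
  refine Finset.sum_le_sum fun t ht => ?_
  have ht' := Finset.mem_range.1 ht
  -- For overall rank `0` the factor `Nat.choose 0 m` leaves only `m = 0`.
  rw [Finset.sum_range_one, Finset.sum_range_succ', Finset.sum_eq_zero]
  · have h1 : (0 : ℝ) < n := by exact_mod_cast hn
    have h2 : ((n - 1).choose t : ℝ) ≠ 0 := by
      exact_mod_cast (Nat.choose_pos (by omega : t ≤ n - 1)).ne'
    simp only [hy, Nat.choose_self, Nat.cast_one, Nat.sub_zero, zero_add, one_mul]
    apply le_of_eq
    field_simp
  · intro m _
    simp

theorem gammaN_le {p : ℝ} (hp : 0 < p) (hp1 : p ≤ 1) (n : ℕ) (hn : 1 ≤ n) :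
    gammaN n p ≤ ratioValue p + 1 / n :=
  ciSup_le (robustRatio_le hp hp1 n hn)

theorem CLPFeasible.le_gammaN {p : ℝ} {α : ℝ → ℕ → ℝ} {γ : ℝ} (h : CLPFeasible p α γ)
    (hp : 0 < p) (hp1 : p ≤ 1) (n : ℕ) (hn : 1 ≤ n) : γ ≤ gammaN n p := by
  obtain ⟨P, hP⟩ := h.exists_le_robustRatio hp n hn
  refine hP.trans (le_ciSup (f := fun P => robustRatio n p P) ?_ P)
  exact ⟨_, Set.forall_mem_range.2 (robustRatio_le hp hp1 n hn)⟩

/-- The continuous bound is squeezed out of the finite one by letting `n → ∞`. -/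
theorem CLPFeasible.le_ratioValue {p : ℝ} {α : ℝ → ℕ → ℝ} {γ : ℝ} (h : CLPFeasible p α γ)
    (hp : 0 < p) (hp1 : p ≤ 1) : γ ≤ ratioValue p := by
  have hlim : Tendsto (fun n : ℕ => ratioValue p + 1 / (n : ℝ)) atTop (𝓝 (ratioValue p)) := by
    simpa using tendsto_one_div_atTop_nhds_zero_nat.const_add (ratioValue p)
  refine ge_of_tendsto hlim ?_
  filter_upwards [eventually_ge_atTop 1] with n hn
  exact (h.le_gammaN hp hp1 n hn).trans (gammaN_le hp hp1 n hn)

theorem CLPFeasible.le_gammaInf {p : ℝ} {α : ℝ → ℕ → ℝ} {γ : ℝ} (h : CLPFeasible p α γ)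
    (hp : 0 < p) (hp1 : p ≤ 1) : γ ≤ gammaInf p :=
  le_csSup ⟨ratioValue p, fun _ ⟨_, h'⟩ => h'.le_ratioValue hp hp1⟩ ⟨α, h⟩

/-! ### Feasible solutions -/

/-- The threshold solution for acceptance probability `p` when each candidate is thinned with
retention probability `ρ`; it is designed for acceptance probability `ρ * p`. -/
def thinnedThreshold (p ρ t : ℝ) (s : ℕ) : ℝ :=
  if s ≠ 0 ∧ cutoff p ≤ t then (1 - ρ) ^ (s - 1) * (ratioValue p / t ^ (1 + p)) else 0

theorem thinnedThreshold_one (p : ℝ) : thinnedThreshold p 1 = thresholdSolution p := by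
  ext t s
  unfold thinnedThreshold thresholdSolution
  rcases s with _ | _ | s <;> simp

/-- Convexity of powers. In the induction, multiplying by `x` leaves an error that is a nonnegative
multiple of `(x - b) ^ 2`. -/
theorem tangent_le_pow {x b : ℝ} (hx : 0 ≤ x) (hb : 0 ≤ b) (j : ℕ) :
    b ^ j + j * b ^ (j - 1) * (x - b) ≤ x ^ j := by
  rcases j with _ | j
  · simp
  induction j with
  | zero => simp
  | succ j ih =>
    have h1 := mul_le_mul_of_nonneg_left ih hx
    have h2 : 0 ≤ ((j : ℝ) + 1) * b ^ j * (x - b) ^ 2 := by positivity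
    simp only [Nat.add_sub_cancel] at h1 ⊢
    push_cast at h1 ⊢
    have e1 : x ^ (j + 1 + 1) = x * x ^ (j + 1) := by ring
    have e2 : b ^ (j + 1 + 1) + ((j : ℝ) + 1 + 1) * b ^ (j + 1) * (x - b) +
        ((j : ℝ) + 1) * b ^ j * (x - b) ^ 2 =
        x * (b ^ (j + 1) + ((j : ℝ) + 1) * b ^ j * (x - b)) := by ring
    rw [e1]; linarith

theorem continuousOn_rpow_cutoff {p : ℝ} (hp : 0 < p) (r : ℝ) :
    ContinuousOn (fun t : ℝ => t ^ r) (Set.Icc (cutoff p) 1) := fun t ht =>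
  (Real.continuousAt_rpow_const t r
    (Or.inl ((cutoff_pos hp).trans_le ht.1).ne')).continuousWithinAt

theorem intervalIntegrable_rpow_mul {p : ℝ} (hp : 0 < p) (hp1 : p ≤ 1) (r : ℝ) (g : ℝ → ℝ)
    (hg : Continuous g) :
    IntervalIntegrable (fun t => t ^ r * g t) volume (cutoff p) 1 :=
  ContinuousOn.intervalIntegrable (by
    rw [Set.uIcc_of_le (cutoff_lt_one hp hp1).le]
    exact (continuousOn_rpow_cutoff hp r).mul hg.continuousOn)

/-- The mean is `(1 - cutoff p ^ (2 - p)) / (2 - p)`, and `1 - p * (2 - p) = (1 - p) ^ 2`. -/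
theorem integral_rpow_mul_id_le {p : ℝ} (hp : 0 < p) (hp1 : p ≤ 1)
    (h : (1 - p) ^ 2 ≤ cutoff p ^ (2 - p)) : ∫ t in cutoff p..1, t ^ (-p) * t ≤ p := by
  have hc := cutoff_pos hp
  have h1 : ∫ t in cutoff p..1, t ^ (-p) * t = ∫ t in cutoff p..1, t ^ (1 - p) := by
    refine intervalIntegral.integral_congr fun t ht => ?_
    rw [Set.uIcc_of_le (cutoff_lt_one hp hp1).le] at ht
    have ht0 : 0 < t := hc.trans_le ht.1
    rw [show 1 - p = -p + 1 by ring, Real.rpow_add ht0, Real.rpow_one]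
  rw [h1, integral_rpow (Or.inl (by linarith)), Real.one_rpow, show 1 - p + 1 = 2 - p by ring,
    div_le_iff₀ (by linarith)]
  linarith [sq_nonneg p, show (1 - p) ^ 2 = 1 - 2 * p + p ^ 2 by ring,
    show p * (2 - p) = 2 * p - p ^ 2 by ring]

/-- Jensen's inequality for the density `t ^ (-p)` on `[cutoff p, 1]`. -/
theorem pow_le_integral {p ρ : ℝ} (hp : 0 < p) (hp1 : p ≤ 1) (hρ : 0 ≤ ρ) (hρ1 : ρ ≤ 1)
    (h : (1 - p) ^ 2 ≤ cutoff p ^ (2 - p)) (j : ℕ) :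
    (1 - ρ * p) ^ j ≤ ∫ t in cutoff p..1, t ^ (-p) * (1 - ρ * t) ^ j := by
  have hc := cutoff_pos hp
  have hc1 := (cutoff_lt_one hp hp1).le
  set b := 1 - ρ * p with hb
  have hb0 : 0 ≤ b := by nlinarith
  have hmass : ∫ t in cutoff p..1, t ^ (-p) = 1 := powerTail_cutoff hp hp1
  have hlin : ∫ t in cutoff p..1, (t ^ (-p) * 1 * (b ^ j + j * b ^ (j - 1) * (ρ * p)) -
      t ^ (-p) * t * (j * b ^ (j - 1) * ρ)) =
      (b ^ j + j * b ^ (j - 1) * (ρ * p)) -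
      (∫ t in cutoff p..1, t ^ (-p) * t) * (j * b ^ (j - 1) * ρ) := by
    rw [intervalIntegral.integral_sub
      ((intervalIntegrable_rpow_mul hp hp1 (-p) (fun _ => 1) continuous_const).mul_const _)
      ((intervalIntegrable_rpow_mul hp hp1 (-p) (fun t => t) continuous_id).mul_const _),
      intervalIntegral.integral_mul_const]
    simp only [mul_one]
    rw [intervalIntegral.integral_mul_const, hmass, one_mul]
  -- The tangent is taken at `p` rather than at the mean; the mean is at most `p` and the slope in
  -- `t` is nonpositive, so the inequality survives.
  have hle : b ^ j ≤ (b ^ j + j * b ^ (j - 1) * (ρ * p)) -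
      (∫ t in cutoff p..1, t ^ (-p) * t) * (j * b ^ (j - 1) * ρ) := by
    have h1 := integral_rpow_mul_id_le hp hp1 h
    have h2 : 0 ≤ j * b ^ (j - 1) * ρ := by positivity
    have h3 := mul_le_mul_of_nonneg_right h1 h2
    have h4 : (j : ℝ) * b ^ (j - 1) * (ρ * p) = p * (j * b ^ (j - 1) * ρ) := by ring
    linarith
  refine hle.trans ?_
  rw [← hlin]
  refine intervalIntegral.integral_mono_on hc1
    (((intervalIntegrable_rpow_mul hp hp1 (-p) (fun _ => 1) continuous_const).mul_const _).sub
      ((intervalIntegrable_rpow_mul hp hp1 (-p) (fun t => t) continuous_id).mul_const _))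
    (intervalIntegrable_rpow_mul hp hp1 (-p) _ (by fun_prop)) fun t ht => ?_
  have ht0 : 0 < t := hc.trans_le ht.1
  have h1 : 0 ≤ 1 - ρ * t := by nlinarith [ht.2]
  have h2 := tangent_le_pow h1 hb0 j
  have h3 := mul_le_mul_of_nonneg_left h2 (Real.rpow_pos_of_pos ht0 (-p)).le
  refine le_trans (le_of_eq ?_) h3
  rw [hb]; ring

/-- The weights `(1 - ρ) ^ m` merge with the binomial law of the better candidates seen so far,
through `(1 - ρ) * t + (1 - t) = 1 - ρ * t`. -/
theorem thinnedThreshold_objective_integrand {p ρ t : ℝ} (hp : 0 < p) (ht : cutoff p ≤ t) (k : ℕ) :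
    ∑ s ∈ Finset.Icc 1 k, thinnedThreshold p ρ t s *
        ∑ l ∈ Finset.Icc s k, ((l - 1).choose (s - 1) : ℝ) * t ^ s * (1 - t) ^ (l - s) =
      ratioValue p * ∑ a ∈ Finset.range k, t ^ (-p) * (1 - ρ * t) ^ a := by
  have ht0 : 0 < t := (cutoff_pos hp).trans_le ht
  rw [objective_sum_eq, Finset.mul_sum]
  refine Finset.sum_congr rfl fun a ha => ?_
  have ha' := Finset.mem_range.1 ha
  have hpow : (1 - ρ * t) ^ a = ∑ m ∈ Finset.range (a + 1),
      ((1 - ρ) * t) ^ m * (1 - t) ^ (a - m) * (a.choose m : ℝ) := by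
    rw [← add_pow]; congr 1; ring
  have hsub : ∑ m ∈ Finset.range (a + 1), thinnedThreshold p ρ t (m + 1) *
      ((a.choose m : ℝ) * (t ^ (m + 1) * (1 - t) ^ (a - m))) =
      ∑ m ∈ Finset.range k, thinnedThreshold p ρ t (m + 1) *
        ((a.choose m : ℝ) * (t ^ (m + 1) * (1 - t) ^ (a - m))) := by
    apply Finset.sum_subset
    · intro m hm
      have := Finset.mem_range.1 hm
      exact Finset.mem_range.2 (by omega)
    · intro m _ hm
      rw [Finset.mem_range] at hm
      simp [(Nat.choose_eq_zero_of_lt (by omega) : a.choose m = 0)]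
  rw [← hsub, hpow, Finset.mul_sum, Finset.mul_sum]
  refine Finset.sum_congr rfl fun m _ => ?_
  have e : t ^ (-p) = t / t ^ (1 + p) := by
    rw [Real.rpow_add ht0, Real.rpow_one, Real.rpow_neg ht0.le]
    have := (Real.rpow_pos_of_pos ht0 p).ne'
    field_simp
  rw [thinnedThreshold, if_pos ⟨by omega, ht⟩, e, mul_pow, Nat.add_sub_cancel]
  ring

theorem tsum_thinnedThreshold {p ρ : ℝ} (hp : 0 < p) (hρ : 0 < ρ) (hρ1 : ρ ≤ 1) (τ : ℝ) :
    ∑' σ : ℕ, ENNReal.ofReal (thinnedThreshold p ρ τ (σ + 1)) =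
      (Set.Ici (cutoff p)).indicator
        (fun τ => ENNReal.ofReal (ratioValue p / ρ * τ ^ (-p - 1))) τ := by
  by_cases h : cutoff p ≤ τ
  · have hτ : 0 < τ := (cutoff_pos hp).trans_le h
    rw [Set.indicator_of_mem (by exact h)]
    have e : ∀ σ : ℕ, thinnedThreshold p ρ τ (σ + 1) =
        (1 - ρ) ^ σ * (ratioValue p / τ ^ (1 + p)) := by
      intro σ
      rw [thinnedThreshold, if_pos ⟨by omega, h⟩, Nat.add_sub_cancel]
    have hV := ratioValue_pos hp
    have hpos : 0 ≤ 1 - ρ := by linarith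
    simp only [e]
    have hs : Summable fun σ : ℕ => (1 - ρ) ^ σ * (ratioValue p / τ ^ (1 + p)) :=
      (summable_geometric_of_lt_one hpos (by linarith)).mul_right _
    rw [← ENNReal.ofReal_tsum_of_nonneg (fun σ => by positivity) hs, tsum_mul_right,
      tsum_geometric_of_lt_one hpos (by linarith), sub_sub_cancel,
      show -p - 1 = -(1 + p) by ring, Real.rpow_neg hτ.le]
    congr 1
    ring
  · rw [Set.indicator_of_notMem (by exact h)]
    simp [thinnedThreshold, h]

/-- The geometric series over partial ranks gives a factor `1 / ρ`, which cancels the `ρ` of the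
acceptance probability. What remains is the constraint for `ρ = 1`, tight at `s = 1` from the cutoff
on. -/
theorem thinnedThreshold_dynamic {p ρ : ℝ} (hp : 0 < p) (hρ : 0 < ρ) (hρ1 : ρ ≤ 1)
    {t : ℝ} (s : ℕ) (hs : 1 ≤ s) :
    ENNReal.ofReal (t * thinnedThreshold p ρ t s) + ENNReal.ofReal (ρ * p) *
      ∫⁻ τ in Set.Icc (0 : ℝ) t, ∑' σ : ℕ, ENNReal.ofReal (thinnedThreshold p ρ τ (σ + 1)) ≤ 1 := by
  have hc := cutoff_pos hp
  simp only [tsum_thinnedThreshold hp hρ hρ1]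
  rw [setLIntegral_indicator measurableSet_Ici]
  have hset : Set.Ici (cutoff p) ∩ Set.Icc 0 t = Set.Icc (cutoff p) t := by
    ext τ
    simp only [Set.mem_inter_iff, Set.mem_Ici, Set.mem_Icc]
    exact ⟨fun h => ⟨h.1, h.2.2⟩, fun h => ⟨h.1, hc.le.trans h.1, h.2⟩⟩
  rw [hset]
  rcases lt_or_ge t (cutoff p) with h | h
  · rw [Set.Icc_eq_empty (not_le.2 h)]
    simp [thinnedThreshold, not_le.2 h]
  have ht : 0 < t := hc.trans_le h
  have hV := ratioValue_pos hp
  have hcV : ratioValue p * cutoff p ^ (-p) = 1 := by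
    rw [Real.rpow_neg hc.le, cutoff_rpow hp, mul_inv_cancel₀ hV.ne']
  have hint : ∫⁻ τ in Set.Icc (cutoff p) t, ENNReal.ofReal (ratioValue p / ρ * τ ^ (-p - 1)) =
      ENNReal.ofReal ((1 - ratioValue p * t ^ (-p)) / (ρ * p)) := by
    have h0 : (0 : ℝ) ∉ Set.uIcc (cutoff p) t := by
      rw [Set.uIcc_of_le h]; exact fun h' => absurd h'.1 (not_le.2 hc)
    have hcont : ContinuousOn (fun τ : ℝ => ratioValue p / ρ * τ ^ (-p - 1))
        (Set.Icc (cutoff p) t) := fun τ hτ =>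
      ((Real.continuousAt_rpow_const τ (-p - 1)
        (Or.inl (hc.trans_le hτ.1).ne')).const_mul _).continuousWithinAt
    rw [← ofReal_integral_eq_lintegral_ofReal (hcont.integrableOn_compact isCompact_Icc),
      integral_Icc_eq_integral_Ioc, ← intervalIntegral.integral_of_le h,
      intervalIntegral.integral_const_mul, integral_rpow (Or.inr ⟨by linarith, h0⟩),
      sub_add_cancel]
    · congr 1
      field_simp
      linear_combination hcV
    · filter_upwards [ae_restrict_mem measurableSet_Icc] with τ hτ
      have := Real.rpow_pos_of_pos (hc.trans_le hτ.1) (-p - 1)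
      simp only [Pi.zero_apply]
      positivity
  have htail : 0 ≤ 1 - ratioValue p * t ^ (-p) := by
    have : t ^ (-p) ≤ cutoff p ^ (-p) := Real.rpow_le_rpow_of_nonpos hc h (by linarith)
    have := mul_le_mul_of_nonneg_left this hV.le
    linarith
  have hfirst : t * thinnedThreshold p ρ t s ≤ ratioValue p * t ^ (-p) := by
    rw [thinnedThreshold, if_pos ⟨by omega, h⟩]
    have e : t * (ratioValue p / t ^ (1 + p)) = ratioValue p * t ^ (-p) := by
      rw [Real.rpow_add ht, Real.rpow_one, Real.rpow_neg ht.le]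
      have := (Real.rpow_pos_of_pos ht p).ne'
      field_simp
    rw [mul_left_comm, e]
    have h1 : (1 - ρ) ^ (s - 1) ≤ 1 := pow_le_one₀ (by linarith) (by linarith)
    have h2 := Real.rpow_pos_of_pos ht (-p)
    exact mul_le_of_le_one_left (by positivity) h1
  rw [hint, ← ENNReal.ofReal_mul (by positivity), mul_div_cancel₀ _ (by positivity)]
  calc _ ≤ ENNReal.ofReal (ratioValue p * t ^ (-p)) +
        ENNReal.ofReal (1 - ratioValue p * t ^ (-p)) := by gcongr
    _ = 1 := by
        have h2 := Real.rpow_pos_of_pos ht (-p)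
        rw [← ENNReal.ofReal_add (by positivity) htail, add_sub_cancel, ENNReal.ofReal_one]

theorem thinnedThreshold_feasible {p ρ : ℝ} (hp : 0 < p) (hp1 : p ≤ 1) (hρ : 0 < ρ) (hρ1 : ρ ≤ 1)
    (h : (1 - p) ^ 2 ≤ cutoff p ^ (2 - p)) :
    CLPFeasible (ρ * p) (thinnedThreshold p ρ) (ratioValue p) where
  measurable s _ := by
    unfold thinnedThreshold
    refine Measurable.ite ?_ (by fun_prop) measurable_const
    by_cases hs : s = 0
    · simp [hs]
    · simp only [ne_eq, hs, not_false_eq_true, true_and]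
      exact measurableSet_Ici
  nonneg t ht s _ := by
    have hV := ratioValue_pos hp
    have ht0 := ht.1
    have : 0 ≤ 1 - ρ := by linarith
    unfold thinnedThreshold
    split_ifs
    · positivity
    · exact le_rfl
  gamma_nonneg := (ratioValue_pos hp).le
  dynamic t _ s hs := thinnedThreshold_dynamic hp hρ hρ1 s hs
  objective k hk := by
    have hc := cutoff_pos hp
    have hc1 := (cutoff_lt_one hp hp1).le
    have hV := ratioValue_pos hp
    have hb : (0 : ℝ) ≤ 1 - ρ * p := by nlinarith
    have hden : 0 < 1 - (1 - ρ * p) ^ k := by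
      have h1 : 0 < ρ * p := by positivity
      have := pow_lt_one₀ hb (by linarith) (by omega : k ≠ 0)
      linarith
    have hint : ∫ t in (0 : ℝ)..1, ∑ s ∈ Finset.Icc 1 k, thinnedThreshold p ρ t s *
        ∑ l ∈ Finset.Icc s k, ((l - 1).choose (s - 1) : ℝ) * t ^ s * (1 - t) ^ (l - s) =
        ∫ t in cutoff p..1, ratioValue p *
          ∑ a ∈ Finset.range k, t ^ (-p) * (1 - ρ * t) ^ a := by
      have e : ∀ t : ℝ, ∑ s ∈ Finset.Icc 1 k, thinnedThreshold p ρ t s *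
          ∑ l ∈ Finset.Icc s k, ((l - 1).choose (s - 1) : ℝ) * t ^ s * (1 - t) ^ (l - s) =
          (Set.Ici (cutoff p)).indicator (fun t => ratioValue p *
            ∑ a ∈ Finset.range k, t ^ (-p) * (1 - ρ * t) ^ a) t := by
        intro t
        by_cases ht : cutoff p ≤ t
        · rw [thinnedThreshold_objective_integrand hp ht, Set.indicator_of_mem (by exact ht)]
        · rw [Set.indicator_of_notMem (by exact ht)]
          simp [thinnedThreshold, ht]
      simp only [e]
      rw [intervalIntegral.integral_of_le zero_le_one, setIntegral_indicator measurableSet_Ici,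
        intervalIntegral.integral_of_le hc1, ← integral_Icc_eq_integral_Ioc]
      congr 2
      ext t
      simp only [Set.mem_inter_iff, Set.mem_Ici, Set.mem_Icc, Set.mem_Ioc]
      exact ⟨fun h => ⟨h.2, h.1.2⟩, fun h => ⟨⟨hc.trans_le h.1, h.2⟩, h.1⟩⟩
    -- Writing the denominator as `ρ * p` times a geometric sum reduces the constraint to a
    -- comparison for each exponent.
    have hgeom := mul_neg_geom_sum (1 - ρ * p) k
    rw [sub_sub_cancel] at hgeom
    rw [hint, le_div_iff₀ hden, intervalIntegral.integral_const_mul,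
      intervalIntegral.integral_finsetSum fun a _ =>
        intervalIntegrable_rpow_mul hp hp1 (-p) _ (by fun_prop), ← hgeom]
    have hsum := Finset.sum_le_sum fun a (_ : a ∈ Finset.range k) =>
      pow_le_integral hp hp1 hρ.le hρ1 h a
    calc ratioValue p * (ρ * p * ∑ a ∈ Finset.range k, (1 - ρ * p) ^ a)
        = ρ * p * (ratioValue p * ∑ a ∈ Finset.range k, (1 - ρ * p) ^ a) := by ring
      _ ≤ _ := by gcongr

/-! ### The critical acceptance probability -/

/-- The logarithm of the quotient of the two sides of the equation for `p^*`. -/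
def criticalLog (r : ℝ) : ℝ := (2 - r) / (1 - r) * Real.log r - 2 * Real.log (1 - r)

/-- Since `(2 - r) / (1 - r) = 1 + 1 / (1 - r)`, the function is `log r`, minus the slope of the
secant of `log` from `1` to `r`, minus `2 * log (1 - r)`. By strict concavity of `log`, all three
contributions increase. -/
theorem criticalLog_strictMono {r s : ℝ} (hr : 0 < r) (hrs : r < s) (hs : s < 1) :
    criticalLog r < criticalLog s := by
  have h1 := strictConcaveOn_log_Ioi.secant_strict_mono (a := 1) (x := r) (y := s)
    (by simp) hr (hr.trans hrs) (by linarith) hs.ne hrs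
  rw [Real.log_one, sub_zero, sub_zero] at h1
  have h2 := Real.log_lt_log hr hrs
  have h3 := Real.log_lt_log (sub_pos.2 hs) (by linarith : 1 - s < 1 - r)
  have e : ∀ x : ℝ, x < 1 → (2 - x) / (1 - x) * Real.log x =
      Real.log x - Real.log x / (x - 1) := by
    intro x hx
    have h4 : 1 - x ≠ 0 := by linarith
    have h5 : x - 1 ≠ 0 := by linarith
    rw [show x - 1 = -(1 - x) by ring]
    field_simp
    ring
  unfold criticalLog
  rw [e r (hrs.trans hs), e s hs]
  linarith

theorem criticalLog_continuousOn : ContinuousOn criticalLog (Set.Icc 0.594 0.595) := by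
  intro r hr
  have h1 : r ≠ 0 := by have := hr.1; norm_num at this; linarith
  have h2 : 1 - r ≠ 0 := by have := hr.2; norm_num at this; linarith
  unfold criticalLog
  exact ((((continuousAt_const.sub continuousAt_id).div (continuousAt_const.sub continuousAt_id)
    h2).mul (Real.continuousAt_log h1)).sub (continuousAt_const.mul
    ((continuousAt_const.sub continuousAt_id).log h2))).continuousWithinAt

theorem log_pow_lt {a b : ℝ} (ha : 0 < a) (m n : ℕ) (h : a ^ m < b ^ n) :
    m * Real.log a < n * Real.log b := by
  rw [← Real.log_pow, ← Real.log_pow]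
  exact Real.log_lt_log (by positivity) h

set_option exponentiation.threshold 2000 in
theorem criticalLog_lower : criticalLog 0.594 < 0 := by
  -- Here `1.406 / 0.406 = 703 / 203`, and `406 = 2 * 203`.
  have h := log_pow_lt (a := 0.594) (b := 0.406) (by norm_num) 703 406 (by norm_num)
  unfold criticalLog
  norm_num at h ⊢
  linarith

set_option exponentiation.threshold 2000 in
theorem criticalLog_upper : 0 < criticalLog 0.595 := by
  -- Here `1.405 / 0.405 = 281 / 81`, and `162 = 2 * 81`.
  have h := log_pow_lt (a := 0.405) (b := 0.595) (by norm_num) 162 281 (by norm_num)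
  unfold criticalLog
  norm_num at h ⊢
  linarith

theorem exists_criticalLog_eq_zero :
    ∃ q : ℝ, 0.594 < q ∧ q < 0.595 ∧ criticalLog q = 0 := by
  obtain ⟨q, hq, h⟩ := intermediate_value_Ioo (by norm_num) criticalLog_continuousOn
    ⟨criticalLog_lower, criticalLog_upper⟩
  exact ⟨q, hq.1, hq.2, h⟩

theorem critical_eq_iff {r : ℝ} (hr : 0 < r) (hr1 : r < 1) :
    r ^ ((2 - r) / (1 - r)) = (1 - r) ^ 2 ↔ criticalLog r = 0 := by
  have h1 : 0 < 1 - r := by linarith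
  rw [← Real.log_injOn_pos.eq_iff (Real.rpow_pos_of_pos hr _ : _ ∈ Set.Ioi _)
    (by positivity : 0 < (1 - r) ^ 2), Real.log_rpow hr, Real.log_pow, criticalLog, sub_eq_zero]
  norm_num

theorem sq_le_cutoff_rpow {q p : ℝ} (hq : 0 < q) (h0 : criticalLog q = 0) (hqp : q ≤ p)
    (hp1 : p ≤ 1) : (1 - p) ^ 2 ≤ cutoff p ^ (2 - p) := by
  have hp : 0 < p := hq.trans_le hqp
  rcases hp1.eq_or_lt with h | h
  · have := Real.rpow_pos_of_pos (cutoff_pos hp) (2 - p)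
    have e : (1 - p) ^ 2 = 0 := by rw [h]; norm_num
    linarith
  · have h1 : 0 ≤ criticalLog p := by
      rcases hqp.eq_or_lt with e | e
      · rw [← e, h0]
      · rw [← h0]; exact (criticalLog_strictMono hq e h).le
    have h2 : 0 < 1 - p := by linarith
    unfold cutoff
    rw [if_neg h.ne, ← Real.rpow_mul hp.le, show 1 / (1 - p) * (2 - p) = (2 - p) / (1 - p) by ring,
      ← Real.log_le_log_iff (by positivity) (by positivity), Real.log_rpow hp, Real.log_pow]
    unfold criticalLog at h1
    push_cast
    linarith

/-- Up to sign this is the slope of the secant of `x * log x` from `1`, which increases by strict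
convexity. -/
theorem ratio_exponent_strictAnti {r s : ℝ} (hr : 0 < r) (hrs : r < s) (hs : s < 1) :
    s / (1 - s) * Real.log s < r / (1 - r) * Real.log r := by
  have h1 := Real.strictConvexOn_mul_log.secant_strict_mono (a := 1) (x := r) (y := s)
    (by simp) hr.le (hr.trans hrs).le (by linarith) hs.ne hrs
  simp only [Real.log_one, mul_zero, sub_zero] at h1
  have e : ∀ x : ℝ, x / (1 - x) * Real.log x = -(x * Real.log x / (x - 1)) := by
    intro x
    rw [← div_neg, neg_sub]; ring
  rw [e, e]
  linarith

set_option exponentiation.threshold 2000 in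
theorem ratio_bounds {q : ℝ} (h1 : 0.594 < q) (h2 : q < 0.595) :
    0.466 < q ^ (q / (1 - q)) ∧ q ^ (q / (1 - q)) < 0.467 := by
  have hq : 0 < q := by norm_num at h1; linarith
  have hq1 : q < 1 := by norm_num at h2; linarith
  have ha := ratio_exponent_strictAnti (by norm_num) h1 hq1
  have hb := ratio_exponent_strictAnti hq h2 (by norm_num)
  -- The exponents come from `0.594 / 0.406 = 297 / 203` and `0.595 / 0.405 = 119 / 81`.
  have h3 := log_pow_lt (a := 0.594) (b := 0.467) (by norm_num) 297 203 (by norm_num)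
  have h4 := log_pow_lt (a := 0.466) (b := 0.595) (by norm_num) 81 119 (by norm_num)
  have hpos := Real.rpow_pos_of_pos hq (q / (1 - q))
  constructor
  · rw [← Real.log_lt_log_iff (by norm_num) hpos, Real.log_rpow hq]
    norm_num at hb h4 ⊢
    linarith
  · rw [← Real.log_lt_log_iff hpos (by norm_num), Real.log_rpow hq]
    norm_num at ha h3 ⊢
    linarith

end SPUA

end

theorem theorem4 :
    ∃ q : ℝ,
      -- `q` is the unique solution of the equation in `(0, 1)`
      (0 < q ∧ q < 1 ∧ q ^ ((2 - q) / (1 - q)) = (1 - q) ^ 2 ∧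
        ∀ r : ℝ, 0 < r → r < 1 → r ^ ((2 - r) / (1 - r)) = (1 - r) ^ 2 → r = q) ∧
      -- the numerical values
      (0.594 < q ∧ q < 0.595) ∧
      (0.466 < q ^ (q / (1 - q)) ∧ q ^ (q / (1 - q)) < 0.467) ∧
      -- large `p`
      (∀ p : ℝ, q ≤ p → p ≤ 1 →
        SPUA.CLPFeasible p (SPUA.thresholdSolution p) (SPUA.ratioValue p) ∧
        SPUA.gammaInf p = SPUA.ratioValue p ∧
        (∀ n : ℕ, 1 ≤ n → SPUA.gammaInf p ≤ SPUA.gammaN n p) ∧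
        Tendsto (fun n : ℕ => SPUA.gammaN n p) atTop (𝓝 (SPUA.gammaInf p))) ∧
      -- small `p`
      (∀ p : ℝ, 0 < p → p ≤ q →
        q ^ (q / (1 - q)) ≤ SPUA.gammaInf p ∧
        ∀ n : ℕ, 1 ≤ n → q ^ (q / (1 - q)) ≤ SPUA.gammaN n p) := by
  obtain ⟨q, h1, h2, h0⟩ := SPUA.exists_criticalLog_eq_zero
  have hq : 0 < q := by norm_num at h1; linarith
  have hq1 : q < 1 := by norm_num at h2; linarith
  have hval : SPUA.ratioValue q = q ^ (q / (1 - q)) := if_neg hq1.ne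
  refine ⟨q, ⟨hq, hq1, (SPUA.critical_eq_iff hq hq1).2 h0, fun r hr hr1 hr2 => ?_⟩, ⟨h1, h2⟩,
    SPUA.ratio_bounds h1 h2, fun p hqp hp1 => ?_, fun p hp hpq => ?_⟩
  · have hr0 := (SPUA.critical_eq_iff hr hr1).1 hr2
    rcases lt_trichotomy r q with h | h | h
    · have := SPUA.criticalLog_strictMono hr h hq1
      linarith
    · exact h
    · have := SPUA.criticalLog_strictMono hq h hr1
      linarith
  · have hp : 0 < p := hq.trans_le hqp
    have hfeas : SPUA.CLPFeasible p (SPUA.thresholdSolution p) (SPUA.ratioValue p) := by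
      have := SPUA.thinnedThreshold_feasible hp hp1 one_pos le_rfl
        (SPUA.sq_le_cutoff_rpow hq h0 hqp hp1)
      rwa [SPUA.thinnedThreshold_one, one_mul] at this
    have hinf : SPUA.gammaInf p = SPUA.ratioValue p :=
      le_antisymm (csSup_le ⟨_, _, hfeas⟩ fun _ ⟨_, h⟩ => h.le_ratioValue hp hp1)
        (hfeas.le_gammaInf hp hp1)
    have hle : ∀ n : ℕ, 1 ≤ n → SPUA.gammaInf p ≤ SPUA.gammaN n p := fun n hn => by
      rw [hinf]; exact hfeas.le_gammaN hp hp1 n hn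
    refine ⟨hfeas, hinf, hle, ?_⟩
    have hlim : Tendsto (fun n : ℕ => SPUA.gammaInf p + 1 / (n : ℝ)) atTop
        (𝓝 (SPUA.gammaInf p)) := by
      simpa using tendsto_one_div_atTop_nhds_zero_nat.const_add (SPUA.gammaInf p)
    refine tendsto_of_tendsto_of_tendsto_of_le_of_le' tendsto_const_nhds hlim ?_ ?_
    · filter_upwards [eventually_ge_atTop 1] with n hn using hle n hn
    · filter_upwards [eventually_ge_atTop 1] with n hn
      rw [hinf]
      exact SPUA.gammaN_le hp hp1 n hn
  · have hp1 : p ≤ 1 := hpq.trans hq1.le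
    -- The retention probability is `p / q`, so that the thinned problem has acceptance probability
    -- exactly `q`.
    have hfeas := SPUA.thinnedThreshold_feasible hq hq1.le (div_pos hp hq) ((div_le_one hq).2 hpq)
      (SPUA.sq_le_cutoff_rpow hq h0 le_rfl hq1.le)
    rw [div_mul_cancel₀ _ hq.ne', hval] at hfeas
    exact ⟨hfeas.le_gammaInf hp hp1, hfeas.le_gammaN hp hp1⟩
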